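/- Let $n\ge 1$. For $v\in\mathbb{Z}$ and $m\in\mathbb{Z}^n$ let $Q_{v,m}=\{x\in\mathbb{R}^n: m_i\le 2^v x_i<m_i+1,\ i=1,\dots,n\}$, with characteristic function $\chi_{v,m}$, and for $P=Q_{J,M}$ put $v_P=J$, $v_P^+=\max(J,0)$. Let $\alpha:\mathbb{R}^n\to\mathbb{R}$ be locally log-Hölder continuous, i.e. for some $c>0$, $|\alpha(x)-\alpha(y)|\le c/\log(e+1/|x-y|)$ for all $x\ne y$. Let $q:\mathbb{R}^n\to[1,\infty)$ be measurable with $1<q^-:=\operatorname{ess\,inf} q\le q^+:=\operatorname{ess\,sup} q<\infty$, such that $1/q$ is locally log-Hölder continuous and there are $g_\infty\in\mathbb{R}$ and $c>0$ with $|1/q(x)-g_\infty|\le c/\log(e+|x|)$ for all $x$. Let $q'(x)=q(x)/(q(x)-1)$. For a complex sequence $s=\{s_{v,m}\}_{v\in\mathbb{N}_0,m\in\mathbb{Z}^n}$ put $$\|s\|_{f_{1,q(\cdot)}^{\alpha(\cdot)}}=\int_{\mathbb{R}^n}\Big(\sum_{v=0}^\infty\Big|\sum_{m\in\mathbb{Z}^n}2^{v(\alpha(x)+n/2)}s_{v,m}\chi_{v,m}(x)\Big|^{q(x)}\Big)^{1/q(x)}dx,$$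 and let $f_{1,q(\cdot)}^{\alpha(\cdot)}$ be the normed space of all $s$ for which this is finite. For $p,r:\mathbb{R}^n\to(0,\infty)$ and a sequence of measurable functions $(g_v)_v$ put $$\varrho_{\ell^{r(\cdot)}(L^{p(\cdot)})}\big((g_v)_v\big)=\sum_v\inf\Big\{l>0:\int_{\mathbb{R}^n}\Big|\frac{g_v(x)}{l^{1/r(x)}}\Big|^{p(x)}dx\le1\Big\},\qquad \|(g_v)_v\|_{\ell^{r(\cdot)}(L^{p(\cdot)})}=\inf\Big\{\mu>0:\varrho_{\ell^{r(\cdot)}(L^{p(\cdot)})}\big((g_v/\mu)_v\big)\le1\Big\}$$ (with $\inf\emptyset=\infty$). Let $\widetilde b:=\widetilde b_{q'(\cdot),q'(\cdot)}^{-\alpha(\cdot),q'(\cdot)}$ be the set of all complex sequences $\lambda=\{\lambda_{v,m}\}_{v\in\mathbb{N}_0,m\in\mathbb{Z}^n}$ with $$\|\lambda\|_{\widetilde b}=\sup_{P}\Big\|\Big(\frac{\sum_{m\in\mathbb{Z}^n}2^{v(-\alpha(\cdot)+n/2)}\lambda_{v,m}\chi_{v,m}}{|P|^{1/q'(\cdot)}}\chi_P\Big)_{v\ge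 v_P^+}\Big\|_{\ell^{q'(\cdot)}(L^{q'(\cdot)})}<\infty,$$ the supremum being taken over all dyadic cubes $P=Q_{J,M}$, $J\in\mathbb{Z}$, $M\in\mathbb{Z}^n$. Then the dual of $f_{1,q(\cdot)}^{\alpha(\cdot)}$ is $\widetilde b$, in the following sense. There are constants $c,C>0$ such that for every $\lambda\in\widetilde b$ the series $$T_\lambda(s)=\sum_{v=0}^\infty\sum_{m\in\mathbb{Z}^n}s_{v,m}\overline{\lambda_{v,m}}$$ converges unconditionally for every $s\in f_{1,q(\cdot)}^{\alpha(\cdot)}$ and defines a continuous linear functional $T_\lambda$ on $f_{1,q(\cdot)}^{\alpha(\cdot)}$ with $$c\,\|\lambda\|_{\widetilde b}\le\|T_\lambda\|_{(f_{1,q(\cdot)}^{\alpha(\cdot)})^*}\le C\,\|\lambda\|_{\widetilde b}.$$ Moreover, every $T\in(f_{1,q(\cdot)}^{\alpha(\cdot)})^*$ is of the form $T=T_\lambda$ for exactly one $\lambda\in\widetilde b$. -/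

import Mathlib

open MeasureTheory
open scoped ENNReal NNReal ComplexConjugate

namespace VarTL

/-- The index set of the pairs `(v, m)`, with `v` a non-negative integer and `m ∈ ℤⁿ`. -/
abbrev Idx (n : ℕ) : Type := ℕ × (Fin n → ℤ)

/-! ### Variable exponents and log-Hölder continuity -/

/-- The class `𝒫`: measurable exponents on `ℝⁿ` with range in `[1, ∞)`. -/
structure MemP {n : ℕ} (q : EuclideanSpace ℝ (Fin n) → ℝ) : Prop where
  measurable : Measurable q
  one_le : ∀ x, 1 ≤ q x

/-- `q⁻`, the essential infimum of a (non-negative) exponent. -/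
noncomputable def expInf {n : ℕ} (q : EuclideanSpace ℝ (Fin n) → ℝ) : ℝ≥0∞ :=
  essInf (fun x => ENNReal.ofReal (q x)) volume

/-- `q⁺`, the essential supremum of a (non-negative) exponent. -/
noncomputable def expSup {n : ℕ} (q : EuclideanSpace ℝ (Fin n) → ℝ) : ℝ≥0∞ :=
  essSup (fun x => ENNReal.ofReal (q x)) volume

/-- The class `C_loc^log` of locally log-Hölder continuous functions. -/
def LocLogHolder {n : ℕ} (g : EuclideanSpace ℝ (Fin n) → ℝ) : Prop :=
  ∃ c : ℝ, 0 < c ∧ ∀ x y, x ≠ y → |g x - g y| ≤ c / Real.log (Real.exp 1 + 1 / ‖x - y‖)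

/-- The log-Hölder decay condition. -/
def LogHolderDecay {n : ℕ} (g : EuclideanSpace ℝ (Fin n) → ℝ) : Prop :=
  ∃ gInf c : ℝ, 0 < c ∧ ∀ x, |g x - gInf| ≤ c / Real.log (Real.exp 1 + ‖x‖)

/-- The class `𝒫^log`: exponents `q ∈ 𝒫` such that `1/q` is globally log-Hölder continuous. -/
structure MemPlog {n : ℕ} (q : EuclideanSpace ℝ (Fin n) → ℝ) : Prop where
  memP : MemP q
  locLogHolder : LocLogHolder (fun x => 1 / q x)
  decay : LogHolderDecay (fun x => 1 / q x)

/-- The pointwise conjugate exponent `q'(x) = q(x) / (q(x) - 1)`, `1/q(x) + 1/q'(x) = 1`. -/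
noncomputable def conjExp {n : ℕ} (q : EuclideanSpace ℝ (Fin n) → ℝ) :
    EuclideanSpace ℝ (Fin n) → ℝ :=
  fun x => Real.conjExponent (q x)

/-! ### The mixed Lebesgue-sequence space `ℓ^{q(·)}(L^{p(·)})` -/

/-- The variable exponent modular `ϱ_{p(·)}(f) = ∫ |f(x)|^{p(x)} dx`. -/
noncomputable def modular {n : ℕ} (p : EuclideanSpace ℝ (Fin n) → ℝ)
    (f : EuclideanSpace ℝ (Fin n) → ℂ) : ℝ≥0∞ :=
  ∫⁻ x, ‖f x‖ₑ ^ p x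

/-- The modular of `ℓ^{q(·)}(L^{p(·)})`:
`∑_v inf {l > 0 : ϱ_{p(·)} (f_v / l^{1/q(·)}) ≤ 1}`, with `inf ∅ = ∞`. -/
noncomputable def mixedModular {n : ℕ} {ι : Type} (p q : EuclideanSpace ℝ (Fin n) → ℝ)
    (f : ι → EuclideanSpace ℝ (Fin n) → ℂ) : ℝ≥0∞ :=
  ∑' v, ⨅ (l : ℝ) (_ : 0 < l ∧ modular p (fun x => f v x / ((l ^ (1 / q x) : ℝ) : ℂ)) ≤ 1),
    ENNReal.ofReal l

/-- The Luxemburg (quasi-)norm of `ℓ^{q(·)}(L^{p(·)})`. -/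
noncomputable def mixedNorm {n : ℕ} {ι : Type} (p q : EuclideanSpace ℝ (Fin n) → ℝ)
    (f : ι → EuclideanSpace ℝ (Fin n) → ℂ) : ℝ≥0∞ :=
  ⨅ (μ : ℝ) (_ : 0 < μ ∧ mixedModular p q (fun v x => f v x / (μ : ℂ)) ≤ 1), ENNReal.ofReal μ

/-! ### Dyadic cubes and the sequence spaces -/

/-- The dyadic cube `Q_{v,m} = {x : m_i ≤ 2^v x_i < m_i + 1 for all i}`, `v ∈ ℤ`, `m ∈ ℤⁿ`. -/
def dyadicCube {n : ℕ} (v : ℤ) (m : Fin n → ℤ) : Set (EuclideanSpace ℝ (Fin n)) :=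
  {x | ∀ i, (m i : ℝ) ≤ (2 : ℝ) ^ v * x i ∧ (2 : ℝ) ^ v * x i < m i + 1}

/-- The function `∑_m 2^{v(α(·)+n/2)} s_{v,m} χ_{v,m}` (at most one term is non-zero at each
point). -/
noncomputable def levelFun {n : ℕ} (α : EuclideanSpace ℝ (Fin n) → ℝ) (s : Idx n → ℂ) (v : ℕ) :
    EuclideanSpace ℝ (Fin n) → ℂ :=
  fun x => ∑' m : Fin n → ℤ, (((2 : ℝ) ^ ((v : ℝ) * (α x + (n : ℝ) / 2)) : ℝ) : ℂ) * s (v, m) *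
    (dyadicCube (v : ℤ) m).indicator 1 x

/-- The (quasi-)norm of the sequence space `b̃_{p(·),q(·)}^{α(·),p(·)}`: the supremum over all
dyadic cubes `P = Q_{J,M}` (so that `v_P = J`) of the `ℓ^{q(·)}(L^{p(·)})`-norms of
`(|P|^{-1/p(·)} ∑_m 2^{v(α(·)+n/2)} lam_{v,m} χ_{v,m} χ_P)`, `v ≥ v_P^+ = max (v_P, 0)`. -/
noncomputable def bNorm {n : ℕ} (α p q : EuclideanSpace ℝ (Fin n) → ℝ) (lam : Idx n → ℂ) : ℝ≥0∞ :=
  ⨆ (J : ℤ) (M : Fin n → ℤ),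
    mixedNorm p q (fun (v : {v : ℕ // max J 0 ≤ (v : ℤ)}) x =>
      levelFun α lam v x / (((volume.real (dyadicCube J M)) ^ (1 / p x) : ℝ) : ℂ) *
        (dyadicCube J M).indicator 1 x)

/-- The sequence space `b̃_{p(·),q(·)}^{α(·),p(·)}`. -/
def bSpace {n : ℕ} (α p q : EuclideanSpace ℝ (Fin n) → ℝ) : Set (Idx n → ℂ) :=
  {lam | bNorm α p q lam < ∞}

/-- The norm of the sequence space `f_{1,q(·)}^{α(·)}`: the `L¹(ℓ^{q(·)})`-norm of
`(∑_m 2^{v(α(·)+n/2)} s_{v,m} χ_{v,m})_{v ≥ 0}`. -/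
noncomputable def fNorm {n : ℕ} (α q : EuclideanSpace ℝ (Fin n) → ℝ) (s : Idx n → ℂ) : ℝ≥0∞ :=
  ∫⁻ x, (∑' v : ℕ, ‖levelFun α s v x‖ₑ ^ q x) ^ (1 / q x)

/-! ### `f_{1,q(·)}^{α(·)}` as a normed space -/

theorem mem_dyadicCube_iff {n : ℕ} (v : ℤ) (m : Fin n → ℤ) (x : EuclideanSpace ℝ (Fin n)) :
    x ∈ dyadicCube v m ↔ m = fun i => ⌊(2 : ℝ) ^ v * x i⌋ := by
  simp only [dyadicCube, Set.mem_ofPred_eq, funext_iff]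
  refine forall_congr' fun i => ?_
  rw [eq_comm, Int.floor_eq_iff]

theorem levelFun_eq {n : ℕ} (α : EuclideanSpace ℝ (Fin n) → ℝ) (s : Idx n → ℂ) (v : ℕ)
    (x : EuclideanSpace ℝ (Fin n)) :
    levelFun α s v x = (((2 : ℝ) ^ ((v : ℝ) * (α x + (n : ℝ) / 2)) : ℝ) : ℂ) *
      s (v, fun i => ⌊(2 : ℝ) ^ (v : ℤ) * x i⌋) := by
  unfold levelFun
  rw [tsum_eq_single (fun i => ⌊(2 : ℝ) ^ (v : ℤ) * x i⌋)]
  · rw [Set.indicator_of_mem ((mem_dyadicCube_iff _ _ _).2 rfl)]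
    simp
  · intro m hm
    rw [Set.indicator_of_notMem (fun h => hm ((mem_dyadicCube_iff _ _ _).1 h))]
    simp

theorem measurable_levelFun {n : ℕ} {α : EuclideanSpace ℝ (Fin n) → ℝ} (hα : Measurable α)
    (s : Idx n → ℂ) (v : ℕ) : Measurable (levelFun α s v) := by
  rw [funext (levelFun_eq α s v)]
  have h1 : Measurable (fun x : EuclideanSpace ℝ (Fin n) =>
      (fun i => ⌊(2 : ℝ) ^ (v : ℤ) * x i⌋ : Fin n → ℤ)) :=
    measurable_pi_lambda _ fun i => Int.measurable_floor.comp (by fun_prop)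
  have h2 : Measurable (fun m : Fin n → ℤ => s (v, m)) := measurable_of_countable _
  have h3 := h2.comp h1
  refine Measurable.mul ?_ h3
  exact Complex.measurable_ofReal.comp (measurable_const.pow (by fun_prop))

/-- The inner `ℓ^{q(x)}`-norm at the point `x`. -/
theorem measurable_inner {n : ℕ} {α q : EuclideanSpace ℝ (Fin n) → ℝ} (hα : Measurable α)
    (hq : Measurable q) (s : Idx n → ℂ) :
    Measurable (fun x => (∑' v : ℕ, ‖levelFun α s v x‖ₑ ^ q x) ^ (1 / q x)) := by
  refine Measurable.pow (Measurable.tsum fun v => ?_) (hq.const_div 1)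
  exact (measurable_levelFun hα s v).enorm.pow hq

theorem fNorm_zero {n : ℕ} (α : EuclideanSpace ℝ (Fin n) → ℝ) {q : EuclideanSpace ℝ (Fin n) → ℝ}
    (hq : MemP q) : fNorm α q 0 = 0 := by
  have h : ∀ x, 0 < q x := fun x => lt_of_lt_of_le one_pos (hq.one_le x)
  simp [fNorm, levelFun_eq, h]

theorem fNorm_add_le {n : ℕ} {α q : EuclideanSpace ℝ (Fin n) → ℝ} (hα : Measurable α)
    (hq : MemP q) (s t : Idx n → ℂ) : fNorm α q (s + t) ≤ fNorm α q s + fNorm α q t := by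
  unfold fNorm
  rw [← lintegral_add_left (measurable_inner hα hq.measurable s)]
  refine lintegral_mono fun x => ?_
  have hx := hq.one_le x
  have h0 : 0 ≤ q x := by linarith
  have key := ENNReal.lintegral_Lp_add_le (μ := (Measure.count : Measure ℕ))
    (f := fun v => ‖levelFun α s v x‖ₑ) (g := fun v => ‖levelFun α t v x‖ₑ)
    (measurable_of_countable _).aemeasurable (measurable_of_countable _).aemeasurable hx
  simp only [lintegral_count] at key
  refine le_trans (ENNReal.rpow_le_rpow (ENNReal.tsum_le_tsum fun v => ?_) (by positivity)) key
  refine ENNReal.rpow_le_rpow ?_ h0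
  have : levelFun α (s + t) v x = levelFun α s v x + levelFun α t v x := by
    simp [levelFun_eq, mul_add]
  rw [this]
  exact enorm_add_le _ _

theorem fNorm_smul {n : ℕ} {α q : EuclideanSpace ℝ (Fin n) → ℝ} (hα : Measurable α)
    (hq : MemP q) (c : ℂ) (s : Idx n → ℂ) : fNorm α q (c • s) = ‖c‖ₑ * fNorm α q s := by
  unfold fNorm
  rw [← lintegral_const_mul _ (measurable_inner hα hq.measurable s)]
  refine lintegral_congr fun x => ?_
  have h0 : 0 < q x := lt_of_lt_of_le one_pos (hq.one_le x)
  have : ∀ v, ‖levelFun α (c • s) v x‖ₑ ^ q x = ‖c‖ₑ ^ q x * ‖levelFun α s v x‖ₑ ^ q x := by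
    intro v
    rw [← ENNReal.mul_rpow_of_nonneg _ _ h0.le, ← enorm_mul]
    congr 2
    simp only [levelFun_eq, Pi.smul_apply, smul_eq_mul]
    ring
  simp only [this]
  rw [ENNReal.tsum_mul_left, ENNReal.mul_rpow_of_nonneg _ _ (by positivity), ← ENNReal.rpow_mul,
    mul_one_div_cancel h0.ne', ENNReal.rpow_one]

theorem volume_dyadicCube_pos {n : ℕ} (v : ℤ) (m : Fin n → ℤ) :
    0 < volume (dyadicCube v m) := by
  have h2 : (0 : ℝ) < (2 : ℝ) ^ v := by positivity
  let U : Set (EuclideanSpace ℝ (Fin n)) :=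
    ⋂ i, {x | (m i : ℝ) < (2 : ℝ) ^ v * x i ∧ (2 : ℝ) ^ v * x i < m i + 1}
  have hU : IsOpen U := by
    refine isOpen_iInter_of_finite fun i => ?_
    have hc : Continuous fun x : EuclideanSpace ℝ (Fin n) => (2 : ℝ) ^ v * x i := by fun_prop
    exact isOpen_Ioo.preimage hc
  have hne : U.Nonempty := by
    refine ⟨WithLp.toLp 2 fun i => ((2 : ℝ) ^ v)⁻¹ * (m i + 1 / 2), ?_⟩
    refine Set.mem_iInter.2 fun i => ?_
    simp only [Set.mem_ofPred_eq]
    rw [mul_inv_cancel_left₀ h2.ne']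
    constructor <;> linarith
  refine lt_of_lt_of_le (hU.measure_pos volume hne) (measure_mono fun x hx i => ?_)
  have := Set.mem_iInter.1 hx i
  exact ⟨this.1.le, this.2⟩

theorem eq_zero_of_fNorm_eq_zero {n : ℕ} {α q : EuclideanSpace ℝ (Fin n) → ℝ} (hα : Measurable α)
    (hq : MemP q) {s : Idx n → ℂ} (h : fNorm α q s = 0) : s = 0 := by
  unfold fNorm at h
  rw [lintegral_eq_zero_iff (measurable_inner hα hq.measurable s)] at h
  funext ⟨v, m⟩
  obtain ⟨x, hxm, hx⟩ : ∃ x ∈ dyadicCube (v : ℤ) m,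
      (∑' v : ℕ, ‖levelFun α s v x‖ₑ ^ q x) ^ (1 / q x) = 0 := by
    by_contra! hcon
    refine (volume_dyadicCube_pos (v : ℤ) m).ne' (measure_mono_null ?_ h)
    intro x hx
    exact hcon x hx
  have h0 : 0 < q x := lt_of_lt_of_le one_pos (hq.one_le x)
  rw [ENNReal.rpow_eq_zero_iff_of_pos (by positivity), ENNReal.tsum_eq_zero] at hx
  have hv := hx v
  rw [ENNReal.rpow_eq_zero_iff_of_pos h0, enorm_eq_zero, levelFun_eq,
    ← (mem_dyadicCube_iff _ _ _).1 hxm, mul_eq_zero] at hv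
  rcases hv with hv | hv
  · have : (0 : ℝ) < (2 : ℝ) ^ ((v : ℝ) * (α x + (n : ℝ) / 2)) := by positivity
    exact absurd (Complex.ofReal_eq_zero.1 hv) this.ne'
  · exact hv

/-- The sequences of finite `fNorm`, as a linear subspace of all sequences. -/
noncomputable def fSubmodule {n : ℕ} (α q : EuclideanSpace ℝ (Fin n) → ℝ) (hα : Measurable α)
    (hq : MemP q) : Submodule ℂ (Idx n → ℂ) where
  carrier := {s | fNorm α q s < ∞}
  zero_mem' := by simp [fNorm_zero α hq]
  add_mem' {s t} hs ht :=
    lt_of_le_of_lt (fNorm_add_le hα hq s t) (ENNReal.add_lt_top.2 ⟨hs, ht⟩)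
  smul_mem' c s hs := by
    change fNorm α q (c • s) < ∞
    rw [fNorm_smul hα hq]
    exact ENNReal.mul_lt_top enorm_lt_top hs

/-- The sequence space `f_{1,q(·)}^{α(·)} = {s : ‖s‖_{f_{1,q(·)}^{α(·)}} < ∞}`; its topology is
that of its norm (and not the product topology). -/
def FSpace {n : ℕ} (α q : EuclideanSpace ℝ (Fin n) → ℝ) (hα : Measurable α) (hq : MemP q) : Type :=
  fSubmodule α q hα hq

namespace FSpace

variable {n : ℕ} {α q : EuclideanSpace ℝ (Fin n) → ℝ} {hα : Measurable α} {hq : MemP q}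

noncomputable instance : AddCommGroup (FSpace α q hα hq) :=
  inferInstanceAs (AddCommGroup (fSubmodule α q hα hq))

noncomputable instance : Module ℂ (FSpace α q hα hq) :=
  inferInstanceAs (Module ℂ (fSubmodule α q hα hq))

/-- The sequence underlying an element of the space. -/
def seq (s : FSpace α q hα hq) : Idx n → ℂ := Subtype.val s

noncomputable instance : Norm (FSpace α q hα hq) := ⟨fun s => (fNorm α q s.seq).toReal⟩

theorem norm_def (s : FSpace α q hα hq) : ‖s‖ = (fNorm α q s.seq).toReal := rfl

theorem fNorm_lt_top (s : FSpace α q hα hq) : fNorm α q s.seq < ∞ := Subtype.property s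

theorem core : NormedSpace.Core ℂ (FSpace α q hα hq) where
  norm_nonneg _ := ENNReal.toReal_nonneg
  norm_smul c s := by
    have h : (c • s).seq = c • s.seq := rfl
    rw [norm_def, norm_def, h, fNorm_smul hα hq, ENNReal.toReal_mul, toReal_enorm]
  norm_triangle s t := by
    have h : (s + t).seq = s.seq + t.seq := rfl
    rw [norm_def, norm_def, norm_def, h,
      ← ENNReal.toReal_add s.fNorm_lt_top.ne t.fNorm_lt_top.ne]
    exact ENNReal.toReal_mono (ENNReal.add_lt_top.2 ⟨s.fNorm_lt_top, t.fNorm_lt_top⟩).ne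
      (fNorm_add_le hα hq _ _)
  norm_eq_zero_iff s := by
    constructor
    · intro h
      rw [norm_def, ENNReal.toReal_eq_zero_iff] at h
      exact Subtype.ext (eq_zero_of_fNorm_eq_zero hα hq (h.resolve_right s.fNorm_lt_top.ne))
    · rintro rfl
      have h : (0 : FSpace α q hα hq).seq = 0 := rfl
      rw [norm_def, h, fNorm_zero α hq, ENNReal.toReal_zero]

noncomputable instance : NormedAddCommGroup (FSpace α q hα hq) := NormedAddCommGroup.ofCore core

noncomputable instance : NormedSpace ℂ (FSpace α q hα hq) := NormedSpace.ofCore core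

end FSpace

theorem LocLogHolder.measurable {n : ℕ} {g : EuclideanSpace ℝ (Fin n) → ℝ} (hg : LocLogHolder g) :
    Measurable g := by
  obtain ⟨c, hc, h⟩ := hg
  refine Continuous.measurable (continuous_iff_continuousAt.2 fun x => ?_)
  rw [← continuousWithinAt_compl_self, ContinuousWithinAt, tendsto_iff_norm_sub_tendsto_zero]
  have h1 : Filter.Tendsto (fun y => ‖y - x‖) (nhdsWithin x {x}ᶜ) (nhdsWithin 0 (Set.Ioi 0)) :=
    tendsto_norm_sub_self_nhdsNE x
  have h2 : Filter.Tendsto (fun y => c / Real.log (Real.exp 1 + 1 / ‖y - x‖))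
      (nhdsWithin x {x}ᶜ) (nhds 0) := by
    refine Filter.Tendsto.const_div_atTop (Real.tendsto_log_atTop.comp ?_) c
    refine Filter.tendsto_atTop_add_const_left _ _ ?_
    simp only [one_div]
    exact tendsto_inv_nhdsGT_zero.comp h1
  refine squeeze_zero' (Filter.Eventually.of_forall fun _ => norm_nonneg _) ?_ h2
  filter_upwards [self_mem_nhdsWithin] with y hy
  rw [Real.norm_eq_abs]
  exact h y x hy

end VarTL

/-!
The duality between `f_{1,q(·)}^{α(·)}` and `b̃_{q'(·),q'(·)}^{-α(·),q'(·)}`.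

When both exponents of the mixed space agree, its modular is the integral of the sum of powers
(`mixedModular_self`). Hence `‖lam‖_{b̃} ≤ μ` is essentially the Carleson condition
`∑_{v ≥ J⁺} ∫_P (|w_v| / μ)^{q'} ≤ |P|` over all dyadic cubes `P = Q_{J,M}`, where
`w_v = ∑_m 2^{v(-α + n/2)} lam_{v,m} χ_{v,m}` (`bNorm_le_of_cubeModular_le`,
`cubeModular_le_of_bNorm_lt`).

*Boundedness of the pairing.* Let `u_v` be the level functions of `s` and `Q = Q_{v,m}`. On `Q`, the
weights in `u_v w_v` cancel, so `|s_Q lam_Q| = ∫_Q |u_v w_v|`, and `Q` may be replaced here by any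
subset of at least half its measure, at the cost of a factor `2`. By Chebyshev's inequality the set
`E_Q ⊆ Q` where `∑_{k ≥ v} (|w_k| / μ)^{q'} ≤ 2` is such a subset. At a given point `x`, the largest
`Q` with `x ∈ E_Q` controls all the others, so the sum of `(|w_v(x)| / μ)^{q'(x)}` over the levels
with `x ∈ E_Q` is at most `2`, and Hölder's inequality in `ℓ^{q(x)}`, `ℓ^{q'(x)}` followed by
integration gives `∑ |s_Q lam_Q| ≤ 4 μ ‖s‖` (`tsum_enorm_mul_enorm_le`).

*Representation of functionals.* As `q⁺ < ∞`, each `s` is the unconditional sum of its coordinates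
(`hasSum_smul_unitSeq`), so a functional `T` is the pairing with `lam_Q = conj (T e_Q)`, and no other
sequence represents it. It remains to bound the `b̃`-norm of `lam` by `‖T‖`. The coefficients of a
functional of small norm have size `W_Q ≤ 1`. By log-Hölder continuity the exponents oscillate by
`O(1/v)` on cubes of level `v`, so `W_Q^{q'(x)}` is constant on `Q` up to a fixed factor whenever
`2^{-v} < W_Q`; the cubes with `W_Q ≤ 2^{-v}` contribute at most a geometric series. On finitely
many cubes of the first kind inside `P`, `T` is tested on `s_Q ∼ 2^{-v(α + n/2)} W_Q^{q' - 1}`. With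
`I = ∑ |Q| W_Q^{q'}` this gives `I = T s ≤ ‖T‖ ‖s‖ ≤ ‖T‖ (|P| + K I)`, because
`(q' - 1) q = q'` and `t^{1/q} ≤ 1 + t`. For small `‖T‖` the last term is absorbed, and `I ≤ |P|`
(`sum_volume_mul_coeffSize_le`); homogeneity gives the general case
(`bNorm_conj_apply_unitSeq_le`).
-/

namespace VarTL

/-! ### Continuity and global bounds of the exponents -/

theorem LocLogHolder.continuous {n : ℕ} {g : EuclideanSpace ℝ (Fin n) → ℝ} (hg : LocLogHolder g) :
    Continuous g := by
  obtain ⟨c, hc, h⟩ := hg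
  refine continuous_iff_continuousAt.2 fun x => ?_
  rw [← continuousWithinAt_compl_self, ContinuousWithinAt, tendsto_iff_norm_sub_tendsto_zero]
  have h1 : Filter.Tendsto (fun y => ‖y - x‖) (nhdsWithin x {x}ᶜ) (nhdsWithin 0 (Set.Ioi 0)) :=
    tendsto_norm_sub_self_nhdsNE x
  have h2 : Filter.Tendsto (fun y => c / Real.log (Real.exp 1 + 1 / ‖y - x‖))
      (nhdsWithin x {x}ᶜ) (nhds 0) := by
    refine Filter.Tendsto.const_div_atTop (Real.tendsto_log_atTop.comp ?_) c
    refine Filter.tendsto_atTop_add_const_left _ _ ?_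
    simp only [one_div]
    exact tendsto_inv_nhdsGT_zero.comp h1
  refine squeeze_zero' (Filter.Eventually.of_forall fun _ => norm_nonneg _) ?_ h2
  filter_upwards [self_mem_nhdsWithin] with y hy
  exact h y x hy

theorem MemPlog.continuous {n : ℕ} {q : EuclideanSpace ℝ (Fin n) → ℝ} (hq : MemPlog q) :
    Continuous q := by
  have h : q = fun x => (1 / q x)⁻¹ := by funext x; simp
  rw [h]
  refine hq.locLogHolder.continuous.inv₀ fun x => ?_
  have := hq.memP.one_le x
  positivity

/-- Since the exponent is continuous, a lower bound on its essential infimum holds everywhere. -/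
theorem MemPlog.exists_lower_bound {n : ℕ} {q : EuclideanSpace ℝ (Fin n) → ℝ} (hq : MemPlog q)
    (h : 1 < expInf q) : ∃ a : ℝ, 1 < a ∧ ∀ x, a ≤ q x := by
  obtain ⟨a, -, ha1, ha⟩ := ENNReal.lt_iff_exists_real_btwn.1 h
  refine ⟨a, by simpa using ha1, ?_⟩
  have hae : ∀ᵐ x, a ≤ q x := by
    filter_upwards [ae_essInf_le (f := fun x => ENNReal.ofReal (q x)) (μ := volume)] with x hx
    have h0 : 0 ≤ q x := zero_le_one.trans (hq.memP.one_le x)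
    exact (ENNReal.ofReal_le_ofReal_iff h0).1 (ha.le.trans hx)
  have hcl : IsClosed {x | a ≤ q x} := isClosed_le continuous_const hq.continuous
  intro x
  have := (Measure.dense_of_ae hae).closure_eq
  rw [hcl.closure_eq] at this
  exact this.ge (Set.mem_univ x)

/-- Since the exponent is continuous, an upper bound on its essential supremum holds everywhere. -/
theorem MemPlog.exists_upper_bound {n : ℕ} {q : EuclideanSpace ℝ (Fin n) → ℝ} (hq : MemPlog q)
    (h : expSup q < ∞) : ∃ b : ℝ, ∀ x, q x ≤ b := by
  refine ⟨(expSup q).toReal, ?_⟩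
  have hae : ∀ᵐ x, q x ≤ (expSup q).toReal := by
    filter_upwards [ae_le_essSup (f := fun x => ENNReal.ofReal (q x)) (μ := volume)] with x hx
    exact (ENNReal.ofReal_le_iff_le_toReal h.ne).1 hx
  have hcl : IsClosed {x | q x ≤ (expSup q).toReal} := isClosed_le hq.continuous continuous_const
  intro x
  have := (Measure.dense_of_ae hae).closure_eq
  rw [hcl.closure_eq] at this
  exact this.ge (Set.mem_univ x)

/-! ### Geometry of dyadic cubes -/

/-- The index `m` of the unique cube `Q_{v,m}` of level `v` that contains `x`. -/
noncomputable def cubeIdx {n : ℕ} (v : ℤ) (x : EuclideanSpace ℝ (Fin n)) : Fin n → ℤ :=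
  fun i => ⌊(2 : ℝ) ^ v * x i⌋

theorem mem_dyadicCube_iff_cubeIdx {n : ℕ} {v : ℤ} {m : Fin n → ℤ} {x : EuclideanSpace ℝ (Fin n)} :
    x ∈ dyadicCube v m ↔ cubeIdx v x = m := by
  rw [mem_dyadicCube_iff, eq_comm]; rfl

theorem mem_dyadicCube_cubeIdx {n : ℕ} (v : ℤ) (x : EuclideanSpace ℝ (Fin n)) :
    x ∈ dyadicCube v (cubeIdx v x) := mem_dyadicCube_iff_cubeIdx.2 rfl

theorem measurable_cubeIdx {n : ℕ} (v : ℤ) :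
    Measurable (cubeIdx v : EuclideanSpace ℝ (Fin n) → Fin n → ℤ) :=
  measurable_pi_lambda _ fun i => Int.measurable_floor.comp (by fun_prop)

theorem measurableSet_dyadicCube {n : ℕ} (v : ℤ) (m : Fin n → ℤ) :
    MeasurableSet (dyadicCube v m) := by
  have h : dyadicCube v m = cubeIdx v ⁻¹' {m} := by
    ext x; simp [mem_dyadicCube_iff_cubeIdx]
  rw [h]
  exact measurable_cubeIdx v (measurableSet_singleton m)

/-- Points of a common cube of a fine level lie in a common cube of every coarser level. -/
theorem cubeIdx_congr_of_le {n : ℕ} {J v : ℤ} (hJ : J ≤ v) {x y : EuclideanSpace ℝ (Fin n)}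
    (h : cubeIdx v x = cubeIdx v y) : cubeIdx J x = cubeIdx J y := by
  obtain ⟨k, rfl⟩ := Int.le.dest hJ
  have key : ∀ z : EuclideanSpace ℝ (Fin n), ∀ i,
      cubeIdx J z i = cubeIdx (J + k) z i / ((2 ^ k : ℕ) : ℤ) := by
    intro z i
    unfold cubeIdx
    rw [← Int.floor_div_natCast]
    congr 1
    rw [zpow_add₀ two_ne_zero]
    push_cast
    rw [zpow_natCast]
    field_simp
  funext i
  rw [key, key, h]

theorem dyadicCube_subset_of_mem {n : ℕ} {J v : ℤ} (hJ : J ≤ v) {M m : Fin n → ℤ}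
    {x : EuclideanSpace ℝ (Fin n)} (hx : x ∈ dyadicCube v m) (hxM : x ∈ dyadicCube J M) :
    dyadicCube v m ⊆ dyadicCube J M := by
  intro y hy
  rw [mem_dyadicCube_iff_cubeIdx] at *
  rw [← hxM]
  exact cubeIdx_congr_of_le hJ (hy.trans hx.symm)

theorem volume_dyadicCube {n : ℕ} (v : ℤ) (m : Fin n → ℤ) :
    volume (dyadicCube v m) = ENNReal.ofReal (((2 : ℝ) ^ v)⁻¹ ^ n) := by
  have h2 : (0 : ℝ) < (2 : ℝ) ^ v := by positivity
  have h : dyadicCube v m = (MeasurableEquiv.toLp 2 (Fin n → ℝ)).symm ⁻¹'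
      (Set.univ.pi fun i => Set.Ico (((2 : ℝ) ^ v)⁻¹ * m i) (((2 : ℝ) ^ v)⁻¹ * (m i + 1))) := by
    ext x
    simp only [dyadicCube, Set.mem_ofPred_eq, Set.mem_preimage, Set.mem_pi, Set.mem_univ,
      true_imp_iff, Set.mem_Ico]
    refine forall_congr' fun i => ?_
    rw [inv_mul_le_iff₀ h2, lt_inv_mul_iff₀ h2]
    rfl
  rw [h, (EuclideanSpace.volume_preserving_symm_measurableEquiv_toLp (Fin n)).measure_preimage
    (MeasurableSet.univ_pi fun i => measurableSet_Ico).nullMeasurableSet, volume_pi_pi]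
  simp only [Real.volume_Ico]
  rw [ENNReal.ofReal_pow (by positivity)]
  simp [← mul_sub]

theorem volume_dyadicCube_ne_top {n : ℕ} (v : ℤ) (m : Fin n → ℤ) :
    volume (dyadicCube v m) ≠ ∞ := by
  rw [volume_dyadicCube]; exact ENNReal.ofReal_ne_top

theorem norm_sub_le_of_mem_dyadicCube {n : ℕ} {v : ℤ} {m : Fin n → ℤ}
    {x y : EuclideanSpace ℝ (Fin n)} (hx : x ∈ dyadicCube v m) (hy : y ∈ dyadicCube v m) :
    ‖x - y‖ ≤ (n + 1) * ((2 : ℝ) ^ v)⁻¹ := by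
  have h2 : (0 : ℝ) < (2 : ℝ) ^ v := by positivity
  rw [EuclideanSpace.norm_eq, Real.sqrt_le_iff]
  refine ⟨by positivity, ?_⟩
  have hi : ∀ i, ‖(x - y) i‖ ^ 2 ≤ (((2 : ℝ) ^ v)⁻¹) ^ 2 := by
    intro i
    have hxi := hx i
    have hyi := hy i
    refine pow_le_pow_left₀ (norm_nonneg _) ?_ 2
    rw [Real.norm_eq_abs, ← mul_le_mul_iff_right₀ h2, mul_inv_cancel₀ h2.ne']
    nth_rw 1 [← abs_of_pos h2]
    rw [← abs_mul, PiLp.sub_apply, mul_sub, abs_le]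
    constructor <;> linarith
  calc ∑ i, ‖(x - y) i‖ ^ 2 ≤ ∑ _i : Fin n, (((2 : ℝ) ^ v)⁻¹) ^ 2 := Finset.sum_le_sum fun i _ => hi i
    _ = n * (((2 : ℝ) ^ v)⁻¹) ^ 2 := by simp
    _ ≤ ((n + 1) * ((2 : ℝ) ^ v)⁻¹) ^ 2 := by
      rw [mul_pow]
      gcongr
      have : (0 : ℝ) ≤ n := n.cast_nonneg
      nlinarith

/-- The corner `2^{-v} m` of the cube `Q_{v,m}`, used as a reference point of the cube. -/
noncomputable def cubeCorner {n : ℕ} (i : Idx n) : EuclideanSpace ℝ (Fin n) :=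
  WithLp.toLp 2 fun k => ((2 : ℝ) ^ (i.1 : ℤ))⁻¹ * i.2 k

theorem cubeCorner_mem {n : ℕ} (i : Idx n) : cubeCorner i ∈ dyadicCube (i.1 : ℤ) i.2 := by
  intro k
  have h2 : (0 : ℝ) < (2 : ℝ) ^ (i.1 : ℤ) := by positivity
  change (i.2 k : ℝ) ≤ 2 ^ (i.1 : ℤ) * (((2 : ℝ) ^ (i.1 : ℤ))⁻¹ * i.2 k) ∧
    2 ^ (i.1 : ℤ) * (((2 : ℝ) ^ (i.1 : ℤ))⁻¹ * i.2 k) < (i.2 k : ℝ) + 1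
  rw [mul_inv_cancel_left₀ h2.ne']
  exact ⟨le_rfl, lt_add_one _⟩

/-- Integrals split over the cubes of a fixed level. -/
theorem lintegral_eq_tsum_dyadicCube {n : ℕ} (v : ℤ) (μ : Measure (EuclideanSpace ℝ (Fin n)))
    (f : EuclideanSpace ℝ (Fin n) → ℝ≥0∞) :
    ∫⁻ x, f x ∂μ = ∑' m : Fin n → ℤ, ∫⁻ x in dyadicCube v m, f x ∂μ := by
  rw [← lintegral_iUnion (fun m => measurableSet_dyadicCube v m)]
  · have : ⋃ m : Fin n → ℤ, dyadicCube v m = Set.univ :=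
      Set.eq_univ_of_forall fun x => Set.mem_iUnion.2 ⟨_, mem_dyadicCube_cubeIdx v x⟩
    rw [this, Measure.restrict_univ]
  · intro m m' hm
    refine Set.disjoint_left.2 fun x hx hx' => hm ?_
    rw [mem_dyadicCube_iff_cubeIdx] at hx hx'
    exact hx.symm.trans hx'

/-! ### Oscillation of log-Hölder functions on dyadic cubes -/

/-- A log-Hölder function oscillates by `O(1/v)` on cubes of side length `2^{-v}`; equivalently
`2^{v g}` is constant on such cubes up to a fixed factor. -/
theorem LocLogHolder.exists_oscillation_bound {n : ℕ} {g : EuclideanSpace ℝ (Fin n) → ℝ}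
    (hg : LocLogHolder g) : ∃ L : ℝ, 0 ≤ L ∧ ∀ (v : ℕ) (m : Fin n → ℤ),
      ∀ x ∈ dyadicCube (v : ℤ) m, ∀ y ∈ dyadicCube (v : ℤ) m, v * |g x - g y| ≤ L := by
  obtain ⟨c, hc, h⟩ := hg
  have hlog2 : 0 < Real.log 2 := Real.log_pos one_lt_two
  have hD : 0 ≤ Real.log (n + 1) := Real.log_nonneg (by simp)
  refine ⟨c * ((1 + Real.log (n + 1)) / Real.log 2), by positivity, fun v m x hx y hy => ?_⟩
  rcases eq_or_ne x y with rfl | hxy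
  · simp only [sub_self, abs_zero, mul_zero]; positivity
  have hpos : 0 < ‖x - y‖ := norm_pos_iff.2 (sub_ne_zero.2 hxy)
  set ℓ := Real.log (Real.exp 1 + 1 / ‖x - y‖) with hℓ
  have hℓ1 : 1 ≤ ℓ := by
    rw [hℓ, Real.le_log_iff_exp_le (by positivity)]
    have : 0 < 1 / ‖x - y‖ := by positivity
    linarith
  have hv : v * Real.log 2 - Real.log (n + 1) ≤ ℓ := by
    rw [← Real.log_pow, ← Real.log_div (by positivity) (by positivity)]
    refine Real.log_le_log (by positivity) ?_
    have h3 := norm_sub_le_of_mem_dyadicCube hx hy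
    have h4 : (2 : ℝ) ^ v / (n + 1) ≤ 1 / ‖x - y‖ := by
      rw [div_le_div_iff₀ (by positivity) hpos, one_mul]
      rw [zpow_natCast, ← div_eq_mul_inv, le_div_iff₀ (by positivity)] at h3
      linarith
    have : 0 < Real.exp 1 := Real.exp_pos 1
    linarith
  have hv' : v ≤ (1 + Real.log (n + 1)) / Real.log 2 * ℓ := by
    rw [div_mul_eq_mul_div, le_div_iff₀ hlog2]
    nlinarith
  calc v * |g x - g y| ≤ v * (c / ℓ) := by gcongr; exact h x y hxy
    _ ≤ ((1 + Real.log (n + 1)) / Real.log 2 * ℓ) * (c / ℓ) := by gcongr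
    _ = c * ((1 + Real.log (n + 1)) / Real.log 2) := by field_simp

/-- The quantitative consequences of the hypotheses on `α` and `q` on which the duality rests:
`q` and its conjugate exponent take values in `(1, R]`, and `α`, `q`, `q'` oscillate by at most
`L / v` on the dyadic cubes of level `v`. -/
structure ExponentControl {n : ℕ} (α q : EuclideanSpace ℝ (Fin n) → ℝ) (L R : ℝ) : Prop where
  L_nonneg : 0 ≤ L
  one_lt : ∀ x, 1 < q x
  le : ∀ x, q x ≤ R
  conj_le : ∀ x, conjExp q x ≤ R
  osc_α : ∀ (v : ℕ) (m : Fin n → ℤ), ∀ x ∈ dyadicCube (v : ℤ) m, ∀ y ∈ dyadicCube (v : ℤ) m,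
    v * |α x - α y| ≤ L
  osc : ∀ (v : ℕ) (m : Fin n → ℤ), ∀ x ∈ dyadicCube (v : ℤ) m, ∀ y ∈ dyadicCube (v : ℤ) m,
    v * |q x - q y| ≤ L
  osc_conj : ∀ (v : ℕ) (m : Fin n → ℤ), ∀ x ∈ dyadicCube (v : ℤ) m, ∀ y ∈ dyadicCube (v : ℤ) m,
    v * |conjExp q x - conjExp q y| ≤ L

namespace ExponentControl

variable {n : ℕ} {α q : EuclideanSpace ℝ (Fin n) → ℝ} {L R : ℝ}

theorem holderConjugate (h : ExponentControl α q L R) (x : EuclideanSpace ℝ (Fin n)) :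
    (q x).HolderConjugate (conjExp q x) := Real.HolderConjugate.conjExponent (h.one_lt x)

theorem one_lt_conj (h : ExponentControl α q L R) (x : EuclideanSpace ℝ (Fin n)) :
    1 < conjExp q x := (h.holderConjugate x).symm.lt

theorem one_le_R (h : ExponentControl α q L R) : 1 ≤ R := (h.one_lt 0).le.trans (h.le 0)

end ExponentControl

theorem abs_sub_le_of_inv {a b R : ℝ} (ha : 0 < a) (hb : 0 < b) (haR : a ≤ R) (hbR : b ≤ R) :
    |a - b| ≤ R ^ 2 * |1 / a - 1 / b| := by
  have h : a - b = -(a * b * (1 / a - 1 / b)) := by field_simp; ring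
  have hab : 0 < a * b := mul_pos ha hb
  have hR : 0 ≤ R := ha.le.trans haR
  rw [h, abs_neg, abs_mul, abs_of_pos hab, sq]
  gcongr

theorem exists_exponentControl {n : ℕ} {α q : EuclideanSpace ℝ (Fin n) → ℝ}
    (hα : LocLogHolder α) (hq : MemPlog q) (hq_inf : 1 < expInf q) (hq_sup : expSup q < ∞) :
    ∃ L R : ℝ, ExponentControl α q L R := by
  obtain ⟨a, ha1, ha⟩ := hq.exists_lower_bound hq_inf
  obtain ⟨b, hb⟩ := hq.exists_upper_bound hq_sup
  obtain ⟨L₁, hL₁, h₁⟩ := hα.exists_oscillation_bound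
  obtain ⟨L₂, hL₂, h₂⟩ := hq.locLogHolder.exists_oscillation_bound
  set R := max b (a / (a - 1)) with hR
  have hone : ∀ x, 1 < q x := fun x => ha1.trans_le (ha x)
  have hconj : ∀ x, (q x).HolderConjugate (conjExp q x) := fun x =>
    Real.HolderConjugate.conjExponent (hone x)
  have hqR : ∀ x, q x ≤ R := fun x => (hb x).trans (le_max_left _ _)
  have hcR : ∀ x, conjExp q x ≤ R := by
    intro x
    refine le_trans ?_ (le_max_right _ _)
    have := hone x
    have := ha x
    rw [conjExp, Real.conjExponent, div_le_div_iff₀ (by linarith) (by linarith)]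
    nlinarith
  have hbound : ∀ d : ℝ, d ≤ L₂ → R ^ 2 * d ≤ L₁ + R ^ 2 * L₂ := fun d hd => by
    have : R ^ 2 * d ≤ R ^ 2 * L₂ := by gcongr
    linarith
  refine ⟨L₁ + R ^ 2 * L₂, R, by positivity, hone, hqR, hcR, fun v m x hx y hy => ?_,
    fun v m x hx y hy => ?_, fun v m x hx y hy => ?_⟩
  · have := h₁ v m x hx y hy
    have : 0 ≤ R ^ 2 * L₂ := by positivity
    linarith
  · refine le_trans ?_ (hbound _ (h₂ v m x hx y hy))
    rw [mul_left_comm]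
    gcongr
    exact abs_sub_le_of_inv (hconj x).pos (hconj y).pos (hqR x) (hqR y)
  · refine le_trans ?_ (hbound _ (h₂ v m x hx y hy))
    rw [mul_left_comm]
    gcongr
    refine (abs_sub_le_of_inv (hconj x).symm.pos (hconj y).symm.pos (hcR x) (hcR y)).trans ?_
    have e : ∀ z, 1 / conjExp q z = 1 - 1 / q z := fun z => by
      have := (hconj z).inv_add_inv_eq_one
      simp only [one_div]; linarith
    rw [e, e, sub_sub_sub_cancel_left, abs_sub_comm]

/-! ### The norm of the `b̃`-space as a Carleson condition -/

/-- When the two exponents agree, the infimum defining one term of the mixed modular equals the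
modular of that term. -/
theorem iInf_modular_div {n : ℕ} {r : EuclideanSpace ℝ (Fin n) → ℝ} (hr : ∀ x, 0 < r x)
    (f : EuclideanSpace ℝ (Fin n) → ℂ) :
    (⨅ (l : ℝ) (_ : 0 < l ∧ modular r (fun x => f x / ((l ^ (1 / r x) : ℝ) : ℂ)) ≤ 1),
      ENNReal.ofReal l) = ∫⁻ x, ‖f x‖ₑ ^ r x := by
  have key : ∀ l : ℝ, 0 < l → (modular r (fun x => f x / ((l ^ (1 / r x) : ℝ) : ℂ)) ≤ 1 ↔
      ∫⁻ x, ‖f x‖ₑ ^ r x ≤ ENNReal.ofReal l) := by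
    intro l hl
    have hl' : ENNReal.ofReal l ≠ 0 := by simpa using hl
    have : modular r (fun x => f x / ((l ^ (1 / r x) : ℝ) : ℂ)) =
        (∫⁻ x, ‖f x‖ₑ ^ r x) / ENNReal.ofReal l := by
      rw [div_eq_mul_inv, ← lintegral_mul_const' _ _ (ENNReal.inv_ne_top.2 hl')]
      refine lintegral_congr fun x => ?_
      have h1 : ‖((l ^ (1 / r x) : ℝ) : ℂ)‖ₑ = ENNReal.ofReal l ^ (1 / r x) := by
        rw [ENNReal.ofReal_rpow_of_pos hl, ← ofReal_norm, Complex.norm_real,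
          Real.norm_of_nonneg (by positivity)]
      have h2 : ((l ^ (1 / r x) : ℝ) : ℂ) ≠ 0 := by
        exact_mod_cast (Real.rpow_pos_of_pos hl _).ne'
      dsimp only
      rw [div_eq_mul_inv, enorm_mul, enorm_inv h2, h1,
        ENNReal.mul_rpow_of_nonneg _ _ (hr x).le, ENNReal.inv_rpow, ← ENNReal.rpow_mul,
        one_div_mul_cancel (hr x).ne', ENNReal.rpow_one]
    rw [this, ENNReal.div_le_iff hl' ENNReal.ofReal_ne_top, one_mul]
  apply le_antisymm
  · refine le_of_forall_gt fun c hc => ?_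
    obtain ⟨l, hl0, hl1, hl2⟩ := ENNReal.lt_iff_exists_real_btwn.1 hc
    have hl : 0 < l := by
      rcases hl0.lt_or_eq with h | rfl
      · exact h
      · simp at hl1
    exact lt_of_le_of_lt (iInf₂_le l ⟨hl, (key l hl).2 hl1.le⟩) hl2
  · exact le_iInf₂ fun l hl => (key l hl.1).1 hl.2

theorem mixedModular_self {n : ℕ} {ι : Type} {r : EuclideanSpace ℝ (Fin n) → ℝ}
    (hr : ∀ x, 0 < r x) (f : ι → EuclideanSpace ℝ (Fin n) → ℂ) :
    mixedModular r r f = ∑' v, ∫⁻ x, ‖f v x‖ₑ ^ r x := by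
  unfold mixedModular
  exact tsum_congr fun v => iInf_modular_div hr (f v)

theorem mixedNorm_le {n : ℕ} {ι : Type} {r : EuclideanSpace ℝ (Fin n) → ℝ}
    (hr : ∀ x, 0 < r x) (f : ι → EuclideanSpace ℝ (Fin n) → ℂ) {μ : ℝ} (hμ : 0 < μ)
    (h : ∑' v, ∫⁻ x, (‖f v x‖ₑ / ENNReal.ofReal μ) ^ r x ≤ 1) :
    mixedNorm r r f ≤ ENNReal.ofReal μ := by
  refine iInf₂_le μ ⟨hμ, ?_⟩
  rw [mixedModular_self hr]
  convert h using 7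
  rw [div_eq_mul_inv, enorm_mul, enorm_inv (by exact_mod_cast hμ.ne'), div_eq_mul_inv,
    ← ofReal_norm (μ : ℂ), Complex.norm_real, Real.norm_of_nonneg hμ.le]

theorem tsum_lintegral_le_one_of_mixedNorm_lt {n : ℕ} {ι : Type}
    {r : EuclideanSpace ℝ (Fin n) → ℝ}
    (hr : ∀ x, 0 < r x) (f : ι → EuclideanSpace ℝ (Fin n) → ℂ) {μ : ℝ}
    (h : mixedNorm r r f < ENNReal.ofReal μ) :
    ∑' v, ∫⁻ x, (‖f v x‖ₑ / ENNReal.ofReal μ) ^ r x ≤ 1 := by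
  simp only [mixedNorm, iInf_lt_iff] at h
  obtain ⟨ν, ⟨hν, hle⟩, hlt⟩ := h
  rw [mixedModular_self hr] at hle
  refine le_trans (ENNReal.tsum_le_tsum fun v => lintegral_mono fun x => ?_) hle
  refine ENNReal.rpow_le_rpow ?_ (hr x).le
  rw [div_eq_mul_inv (f v x), enorm_mul, enorm_inv (by exact_mod_cast hν.ne'), div_eq_mul_inv,
    ← ofReal_norm (ν : ℂ), Complex.norm_real, Real.norm_of_nonneg hν.le]
  gcongr

/-- The modular of the tail `v ≥ J⁺` of `lam / μ` over the cube `Q_{J,M}`. -/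
noncomputable def cubeModular {n : ℕ} (α r : EuclideanSpace ℝ (Fin n) → ℝ) (lam : Idx n → ℂ)
    (μ : ℝ) (J : ℤ) (M : Fin n → ℤ) : ℝ≥0∞ :=
  ∑' v : {v : ℕ // max J 0 ≤ (v : ℤ)}, ∫⁻ x in dyadicCube J M,
    (‖levelFun α lam v x‖ₑ / ENNReal.ofReal μ) ^ r x

theorem tsum_lintegral_normalized_eq {n : ℕ} {α r : EuclideanSpace ℝ (Fin n) → ℝ}
    (hr : ∀ x, 0 < r x) (lam : Idx n → ℂ) (μ : ℝ) (J : ℤ) (M : Fin n → ℤ) :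
    ∑' v : {v : ℕ // max J 0 ≤ (v : ℤ)}, ∫⁻ x, (‖levelFun α lam v x /
        (((volume.real (dyadicCube J M)) ^ (1 / r x) : ℝ) : ℂ) *
        (dyadicCube J M).indicator 1 x‖ₑ / ENNReal.ofReal μ) ^ r x =
      cubeModular α r lam μ J M / volume (dyadicCube J M) := by
  have hne := (volume_dyadicCube_pos J M).ne'
  have htop := volume_dyadicCube_ne_top J M
  have hreal : 0 < volume.real (dyadicCube J M) := ENNReal.toReal_pos hne htop
  unfold cubeModular
  rw [div_eq_mul_inv, ← ENNReal.tsum_mul_right]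
  refine tsum_congr fun v => ?_
  rw [← lintegral_mul_const' _ _ (ENNReal.inv_ne_top.2 hne),
    ← lintegral_indicator (measurableSet_dyadicCube J M)]
  refine lintegral_congr fun x => ?_
  by_cases hx : x ∈ dyadicCube J M
  · have h1 : ‖((volume.real (dyadicCube J M) ^ (1 / r x) : ℝ) : ℂ)‖ₑ =
        volume (dyadicCube J M) ^ (1 / r x) := by
      rw [← ofReal_norm, Complex.norm_real, Real.norm_of_nonneg (by positivity),
        ← ENNReal.ofReal_rpow_of_pos hreal, Measure.real, ENNReal.ofReal_toReal htop]
    have h2 : ((volume.real (dyadicCube J M) ^ (1 / r x) : ℝ) : ℂ) ≠ 0 := by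
      exact_mod_cast (Real.rpow_pos_of_pos hreal _).ne'
    rw [Set.indicator_of_mem hx, Set.indicator_of_mem hx, Pi.one_apply, mul_one,
      div_eq_mul_inv (levelFun α lam v x), enorm_mul, enorm_inv h2, h1, ENNReal.mul_div_right_comm,
      ENNReal.mul_rpow_of_nonneg _ (volume (dyadicCube J M) ^ (1 / r x))⁻¹ (hr x).le,
      ENNReal.inv_rpow (volume (dyadicCube J M) ^ (1 / r x)), ← ENNReal.rpow_mul,
      one_div_mul_cancel (hr x).ne', ENNReal.rpow_one]
  · rw [Set.indicator_of_notMem hx, Set.indicator_of_notMem hx]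
    simp [hr x]

theorem bNorm_le_of_cubeModular_le {n : ℕ} {α r : EuclideanSpace ℝ (Fin n) → ℝ}
    (hr : ∀ x, 0 < r x) {lam : Idx n → ℂ} {μ : ℝ} (hμ : 0 < μ)
    (h : ∀ J M, cubeModular α r lam μ J M ≤ volume (dyadicCube J M)) :
    bNorm α r r lam ≤ ENNReal.ofReal μ := by
  refine iSup₂_le fun J M => mixedNorm_le hr _ hμ ?_
  rw [tsum_lintegral_normalized_eq hr,
    ENNReal.div_le_iff (volume_dyadicCube_pos J M).ne' (volume_dyadicCube_ne_top J M), one_mul]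
  exact h J M

theorem cubeModular_le_of_bNorm_lt {n : ℕ} {α r : EuclideanSpace ℝ (Fin n) → ℝ}
    (hr : ∀ x, 0 < r x) {lam : Idx n → ℂ} {μ : ℝ} (h : bNorm α r r lam < ENNReal.ofReal μ)
    (J : ℤ) (M : Fin n → ℤ) : cubeModular α r lam μ J M ≤ volume (dyadicCube J M) := by
  have h1 := tsum_lintegral_le_one_of_mixedNorm_lt hr _
    (lt_of_le_of_lt (le_iSup₂ (f := fun (J : ℤ) (M : Fin n → ℤ) =>
      mixedNorm r r (fun (v : {v : ℕ // max J 0 ≤ (v : ℤ)}) x =>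
      levelFun α lam v x / (((volume.real (dyadicCube J M)) ^ (1 / r x) : ℝ) : ℂ) *
        (dyadicCube J M).indicator 1 x)) J M) h)
  rwa [tsum_lintegral_normalized_eq hr,
    ENNReal.div_le_iff (volume_dyadicCube_pos J M).ne' (volume_dyadicCube_ne_top J M),
    one_mul] at h1

/-! ### Boundedness of the pairing -/

/-- The tail `∑_{k ≥ v} (|∑_m 2^{k(α+n/2)} lam_{k,m} χ_{k,m}| / μ)^r` of the pointwise modular. -/
noncomputable def tailSum {n : ℕ} (α r : EuclideanSpace ℝ (Fin n) → ℝ) (lam : Idx n → ℂ)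
    (μ : ℝ) (v : ℕ) (x : EuclideanSpace ℝ (Fin n)) : ℝ≥0∞ :=
  ∑' k : {k : ℕ // v ≤ k}, (‖levelFun α lam k x‖ₑ / ENNReal.ofReal μ) ^ r x

theorem measurable_level_modular {n : ℕ} {α r : EuclideanSpace ℝ (Fin n) → ℝ} (hα : Measurable α)
    (hr : Measurable r) (lam : Idx n → ℂ) (μ : ℝ) (v : ℕ) :
    Measurable fun x => (‖levelFun α lam v x‖ₑ / ENNReal.ofReal μ) ^ r x :=
  ((measurable_levelFun hα lam v).enorm.div_const _).pow hr

theorem measurable_tailSum {n : ℕ} {α r : EuclideanSpace ℝ (Fin n) → ℝ} (hα : Measurable α)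
    (hr : Measurable r) (lam : Idx n → ℂ) (μ : ℝ) (v : ℕ) :
    Measurable (tailSum α r lam μ v) :=
  Measurable.tsum fun _ => measurable_level_modular hα hr lam μ _

/-- By Chebyshev's inequality, the tail from level `v` on is at most `2` on at least half of each
cube of level `v`. -/
theorem volume_dyadicCube_le_two_mul {n : ℕ} {α r : EuclideanSpace ℝ (Fin n) → ℝ}
    (hα : Measurable α) (hr : Measurable r) {lam : Idx n → ℂ} {μ : ℝ} {v : ℕ} {m : Fin n → ℤ}
    (h : cubeModular α r lam μ v m ≤ volume (dyadicCube v m)) :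
    volume (dyadicCube (v : ℤ) m) ≤
      2 * volume (dyadicCube (v : ℤ) m ∩ {x | tailSum α r lam μ v x ≤ 2}) := by
  set Q := dyadicCube (n := n) (v : ℤ) m with hQ
  have hmeas := measurable_tailSum hα hr lam μ v
  have hint : ∫⁻ x in Q, tailSum α r lam μ v x ≤ volume Q := by
    refine le_trans (le_of_eq ?_) h
    unfold tailSum cubeModular
    rw [lintegral_tsum fun k : {k : ℕ // v ≤ k} =>
      (measurable_level_modular hα hr lam μ k).aemeasurable]
    refine (Equiv.subtypeEquivRight fun k => ?_).tsum_eq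
      (fun k : {k : ℕ // max (v : ℤ) 0 ≤ (k : ℤ)} =>
        ∫⁻ x in Q, (‖levelFun α lam k x‖ₑ / ENNReal.ofReal μ) ^ r x)
    omega
  have hcheb := (mul_meas_ge_le_lintegral (μ := volume.restrict Q) hmeas 2).trans hint
  have hbad : volume.restrict Q {x | tailSum α r lam μ v x ≤ 2}ᶜ ≤
      volume.restrict Q {x | 2 ≤ tailSum α r lam μ v x} := by
    refine measure_mono fun x hx => ?_
    simp only [Set.mem_compl_iff, Set.mem_ofPred_eq, not_le] at hx ⊢
    exact hx.le
  have hE : MeasurableSet {x | tailSum α r lam μ v x ≤ 2} := measurableSet_le hmeas measurable_const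
  have hsum := measure_add_measure_compl (μ := volume.restrict Q) hE
  rw [Measure.restrict_apply_univ, Measure.restrict_apply hE, Set.inter_comm] at hsum
  have htop : volume Q ≠ ∞ := volume_dyadicCube_ne_top _ _
  have h2 : 2 * volume Q ≤ 2 * volume (Q ∩ {x | tailSum α r lam μ v x ≤ 2}) + volume Q := by
    nth_rw 1 [← hsum]
    rw [mul_add]
    gcongr
    exact (mul_le_mul_right hbad 2).trans hcheb
  rw [two_mul (volume Q)] at h2
  exact (ENNReal.add_le_add_iff_right htop).1 h2

/-- At each point, summing only over the levels from which the tail is at most `2` gives at most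
`2`: the first of these levels controls all the others. -/
theorem tsum_indicator_tailSum_le {n : ℕ} (α r : EuclideanSpace ℝ (Fin n) → ℝ) (lam : Idx n → ℂ)
    (μ : ℝ) (x : EuclideanSpace ℝ (Fin n)) :
    ∑' v : ℕ, {v | tailSum α r lam μ v x ≤ 2}.indicator
      (fun v => (‖levelFun α lam v x‖ₑ / ENNReal.ofReal μ) ^ r x) v ≤ 2 := by
  classical
  by_cases hne : ∃ v, tailSum α r lam μ v x ≤ 2
  · refine le_trans ?_ (Nat.find_spec hne)
    have htail : tailSum α r lam μ (Nat.find hne) x = ∑' v, {k | Nat.find hne ≤ k}.indicator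
        (fun v => (‖levelFun α lam v x‖ₑ / ENNReal.ofReal μ) ^ r x) v :=
      tsum_subtype {k | Nat.find hne ≤ k}
        (fun v => (‖levelFun α lam v x‖ₑ / ENNReal.ofReal μ) ^ r x)
    rw [htail]
    refine ENNReal.tsum_le_tsum fun v => ?_
    refine Set.indicator_le_indicator_of_subset (fun k hk => ?_) (fun _ => zero_le) v
    exact Nat.find_min' hne hk
  · have : {v | tailSum α r lam μ v x ≤ 2} = ∅ :=
      Set.eq_empty_of_forall_notMem fun v hv => hne ⟨v, hv⟩
    simp [this]

theorem tsum_mul_le_Lp_mul_Lq (f g : ℕ → ℝ≥0∞) {p q : ℝ} (h : p.HolderConjugate q) :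
    ∑' v, f v * g v ≤ (∑' v, f v ^ p) ^ (1 / p) * (∑' v, g v ^ q) ^ (1 / q) := by
  have key := ENNReal.lintegral_mul_le_Lp_mul_Lq (Measure.count : Measure ℕ) h
    (f := f) (g := g) (measurable_of_countable _).aemeasurable
    (measurable_of_countable _).aemeasurable
  simpa only [lintegral_count, Pi.mul_apply] using key

theorem enorm_levelFun_eq_of_mem {n : ℕ} (α : EuclideanSpace ℝ (Fin n) → ℝ) (s : Idx n → ℂ) {v : ℕ}
    {m : Fin n → ℤ} {x : EuclideanSpace ℝ (Fin n)} (hx : x ∈ dyadicCube (v : ℤ) m) :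
    ‖levelFun α s v x‖ₑ =
      ENNReal.ofReal ((2 : ℝ) ^ ((v : ℝ) * (α x + (n : ℝ) / 2))) * ‖s (v, m)‖ₑ := by
  rw [levelFun_eq, ← (mem_dyadicCube_iff _ _ _).1 hx, enorm_mul, ← ofReal_norm,
    Complex.norm_real, Real.norm_of_nonneg (by positivity)]

/-- The weights `2^{vα}` and `2^{-vα}` cancel, so that the product of the two level functions is
constant on the cubes of level `v`. -/
theorem volume_mul_enorm_levelFun_mul {n : ℕ} (α : EuclideanSpace ℝ (Fin n) → ℝ)
    (s lam : Idx n → ℂ) {v : ℕ} {m : Fin n → ℤ} {x : EuclideanSpace ℝ (Fin n)}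
    (hx : x ∈ dyadicCube (v : ℤ) m) :
    volume (dyadicCube (v : ℤ) m) *
      (‖levelFun α s v x‖ₑ * ‖levelFun (fun x => -α x) lam v x‖ₑ) =
      ‖s (v, m)‖ₑ * ‖lam (v, m)‖ₑ := by
  rw [enorm_levelFun_eq_of_mem α s hx, enorm_levelFun_eq_of_mem _ lam hx, volume_dyadicCube,
    mul_mul_mul_comm, ← mul_assoc, ← ENNReal.ofReal_mul (by positivity),
    ← ENNReal.ofReal_mul (by positivity), ← Real.rpow_add two_pos]
  have : (v : ℝ) * (α x + n / 2) + v * (-α x + n / 2) = ((v * n : ℕ) : ℝ) := by push_cast; ring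
  rw [this, Real.rpow_natCast, zpow_natCast, inv_pow, ← pow_mul,
    inv_mul_cancel₀ (by positivity), ENNReal.ofReal_one, one_mul]

theorem tsum_enorm_mul_le_lintegral {n : ℕ} {α r : EuclideanSpace ℝ (Fin n) → ℝ}
    (hα : Measurable α) (hr : Measurable r) {lam : Idx n → ℂ} {μ : ℝ}
    (h : ∀ J M, cubeModular (fun x => -α x) r lam μ J M ≤ volume (dyadicCube J M))
    (s : Idx n → ℂ) (v : ℕ) :
    ∑' m, ‖s (v, m)‖ₑ * ‖lam (v, m)‖ₑ ≤
      2 * ∫⁻ x in {x | tailSum (fun x => -α x) r lam μ v x ≤ 2},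
        ‖levelFun α s v x‖ₑ * ‖levelFun (fun x => -α x) lam v x‖ₑ := by
  rw [lintegral_eq_tsum_dyadicCube (v : ℤ), ← ENNReal.tsum_mul_left]
  refine ENNReal.tsum_le_tsum fun m => ?_
  set Q := dyadicCube (n := n) (v : ℤ) m
  set E := {x | tailSum (fun x => -α x) r lam μ v x ≤ 2}
  have h0 : volume Q ≠ 0 := (volume_dyadicCube_pos _ _).ne'
  have htop : volume Q ≠ ∞ := volume_dyadicCube_ne_top _ _
  have hconst : ∫⁻ x in Q, ‖levelFun α s v x‖ₑ * ‖levelFun (fun x => -α x) lam v x‖ₑ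
      ∂(volume.restrict E) =
      (volume Q)⁻¹ * (‖s (v, m)‖ₑ * ‖lam (v, m)‖ₑ) * volume (Q ∩ E) := by
    rw [setLIntegral_congr_fun (g := fun _ => (volume Q)⁻¹ * (‖s (v, m)‖ₑ * ‖lam (v, m)‖ₑ))
      (measurableSet_dyadicCube _ _)]
    · rw [setLIntegral_const, Measure.restrict_apply (measurableSet_dyadicCube _ _)]
    · intro x hx
      change _ = (volume Q)⁻¹ * _
      rw [← volume_mul_enorm_levelFun_mul α s lam hx, ← mul_assoc,
        ENNReal.inv_mul_cancel h0 htop, one_mul]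
  rw [hconst]
  calc ‖s (v, m)‖ₑ * ‖lam (v, m)‖ₑ
      = (volume Q)⁻¹ * (‖s (v, m)‖ₑ * ‖lam (v, m)‖ₑ) * volume Q := by
        rw [mul_right_comm, ENNReal.inv_mul_cancel h0 htop, one_mul]
    _ ≤ (volume Q)⁻¹ * (‖s (v, m)‖ₑ * ‖lam (v, m)‖ₑ) * (2 * volume (Q ∩ E)) := by
        gcongr
        exact volume_dyadicCube_le_two_mul hα.neg hr (h v m)
    _ = _ := by ring

/-- The pairing is absolutely convergent and bounded: each cube `Q` is replaced by the part of `Q`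
on which the tail of `lam` below `Q` is small, and Hölder's inequality is applied pointwise. -/
theorem tsum_enorm_mul_enorm_le {n : ℕ} {α q : EuclideanSpace ℝ (Fin n) → ℝ} (hα : Measurable α)
    (hq : Measurable q) (hconj : ∀ x, (q x).HolderConjugate (conjExp q x)) {lam : Idx n → ℂ}
    {μ : ℝ} (hμ : 0 < μ) (h : bNorm (fun x => -α x) (conjExp q) (conjExp q) lam < ENNReal.ofReal μ)
    (s : Idx n → ℂ) :
    ∑' i, ‖s i‖ₑ * ‖lam i‖ₑ ≤ 4 * ENNReal.ofReal μ * fNorm α q s := by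
  set r := conjExp q with hr
  have hrm : Measurable r := hq.div (hq.sub_const 1)
  have hr1 : ∀ x, 1 < r x := fun x => (hconj x).symm.lt
  have hcube := cubeModular_le_of_bNorm_lt (fun x => (zero_lt_one.trans (hr1 x))) h
  have hμ0 : ENNReal.ofReal μ ≠ 0 := by simpa using hμ
  have hE : ∀ v, MeasurableSet {x | tailSum (fun x => -α x) r lam μ v x ≤ 2} := fun v =>
    measurableSet_le (measurable_tailSum hα.neg hrm lam μ v) measurable_const
  have hfg : ∀ v, Measurable fun x =>
      ‖levelFun α s v x‖ₑ * ‖levelFun (fun x => -α x) lam v x‖ₑ := fun v =>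
    (measurable_levelFun hα s v).enorm.mul (measurable_levelFun hα.neg lam v).enorm
  calc ∑' i, ‖s i‖ₑ * ‖lam i‖ₑ = ∑' v, ∑' m, ‖s (v, m)‖ₑ * ‖lam (v, m)‖ₑ :=
        ENNReal.tsum_prod (f := fun v m => ‖s (v, m)‖ₑ * ‖lam (v, m)‖ₑ)
    _ ≤ ∑' v, 2 * ∫⁻ x in {x | tailSum (fun x => -α x) r lam μ v x ≤ 2},
        ‖levelFun α s v x‖ₑ * ‖levelFun (fun x => -α x) lam v x‖ₑ :=
        ENNReal.tsum_le_tsum fun v => tsum_enorm_mul_le_lintegral hα hrm hcube s v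
    _ = 2 * ∫⁻ x, ∑' v, {x | tailSum (fun x => -α x) r lam μ v x ≤ 2}.indicator
        (fun x => ‖levelFun α s v x‖ₑ * ‖levelFun (fun x => -α x) lam v x‖ₑ) x := by
        rw [ENNReal.tsum_mul_left,
          lintegral_tsum fun v => ((hfg v).indicator (hE v)).aemeasurable]
        congr 2
        funext v
        rw [lintegral_indicator (hE v)]
    _ ≤ 2 * ∫⁻ x, (2 * ENNReal.ofReal μ) * (∑' v : ℕ, ‖levelFun α s v x‖ₑ ^ q x) ^ (1 / q x) := by
        gcongr with x
        have hsum := tsum_indicator_tailSum_le (fun x => -α x) r lam μ x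
        set G : ℕ → ℝ≥0∞ := {v | tailSum (fun x => -α x) r lam μ v x ≤ 2}.indicator
          (fun v => ‖levelFun (fun x => -α x) lam v x‖ₑ / ENNReal.ofReal μ) with hG
        have hG2 : (∑' v, G v ^ r x) ^ (1 / r x) ≤ 2 := by
          have h1 : ∑' v, G v ^ r x ≤ 2 := by
            refine le_trans (le_of_eq (tsum_congr fun v => ?_)) hsum
            by_cases hv : v ∈ {v | tailSum (fun x => -α x) r lam μ v x ≤ 2}
            · rw [hG, Set.indicator_of_mem hv, Set.indicator_of_mem hv]
            · rw [hG, Set.indicator_of_notMem hv, Set.indicator_of_notMem hv,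
                ENNReal.zero_rpow_of_pos (zero_lt_one.trans (hr1 x))]
          calc (∑' v, G v ^ r x) ^ (1 / r x) ≤ 2 ^ (1 / r x) := by
                gcongr
                exact one_div_nonneg.2 (zero_le_one.trans (hr1 x).le)
            _ ≤ 2 ^ (1 : ℝ) := by
                refine ENNReal.rpow_le_rpow_of_exponent_le one_le_two ?_
                exact (div_le_one (zero_lt_one.trans (hr1 x))).2 (hr1 x).le
            _ = 2 := ENNReal.rpow_one 2
        calc ∑' v, {x | tailSum (fun x => -α x) r lam μ v x ≤ 2}.indicator
              (fun x => ‖levelFun α s v x‖ₑ * ‖levelFun (fun x => -α x) lam v x‖ₑ) x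
            = ∑' v, ENNReal.ofReal μ * (‖levelFun α s v x‖ₑ * G v) := by
              refine tsum_congr fun v => ?_
              by_cases hv : tailSum (fun x => -α x) r lam μ v x ≤ 2
              · have hx : x ∈ {x | tailSum (fun x => -α x) r lam μ v x ≤ 2} := hv
                have hv' : v ∈ {v | tailSum (fun x => -α x) r lam μ v x ≤ 2} := hv
                rw [Set.indicator_of_mem hx, hG, Set.indicator_of_mem hv', mul_left_comm,
                  ENNReal.mul_div_cancel hμ0 ENNReal.ofReal_ne_top]
              · have hx : x ∉ {x | tailSum (fun x => -α x) r lam μ v x ≤ 2} := hv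
                have hv' : v ∉ {v | tailSum (fun x => -α x) r lam μ v x ≤ 2} := hv
                rw [Set.indicator_of_notMem hx, hG, Set.indicator_of_notMem hv', mul_zero, mul_zero]
          _ ≤ ENNReal.ofReal μ * ((∑' v : ℕ, ‖levelFun α s v x‖ₑ ^ q x) ^ (1 / q x) * 2) := by
              rw [ENNReal.tsum_mul_left]
              gcongr
              exact (tsum_mul_le_Lp_mul_Lq _ _ (hconj x)).trans (by gcongr)
          _ = _ := by ring
    _ = 4 * ENNReal.ofReal μ * fNorm α q s := by
        rw [lintegral_const_mul _ (measurable_inner hα hq s), fNorm]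
        ring

/-! ### Unit sequences and finite partial sums -/

theorem fNorm_single_le {n : ℕ} {α q : EuclideanSpace ℝ (Fin n) → ℝ} {L R : ℝ}
    (h : ExponentControl α q L R) (v : ℕ) (m : Fin n → ℤ) {y : EuclideanSpace ℝ (Fin n)}
    (hy : y ∈ dyadicCube (v : ℤ) m) :
    fNorm α q (Pi.single (v, m) 1) ≤
      ENNReal.ofReal (2 ^ L * 2 ^ ((v : ℝ) * (α y - (n : ℝ) / 2))) := by
  have hbound : ∀ x, (∑' k : ℕ, ‖levelFun α (Pi.single (v, m) 1) k x‖ₑ ^ q x) ^ (1 / q x) ≤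
      (dyadicCube (v : ℤ) m).indicator
        (fun _ => ENNReal.ofReal (2 ^ L * 2 ^ ((v : ℝ) * (α y + (n : ℝ) / 2)))) x := by
    intro x
    have hq0 : 0 < q x := zero_lt_one.trans (h.one_lt x)
    rw [tsum_eq_single v, ← ENNReal.rpow_mul, mul_one_div_cancel hq0.ne', ENNReal.rpow_one]
    · by_cases hx : x ∈ dyadicCube (v : ℤ) m
      · rw [Set.indicator_of_mem hx, enorm_levelFun_eq_of_mem α _ hx, Pi.single_eq_same,
          enorm_one, mul_one, ← Real.rpow_add two_pos]
        refine ENNReal.ofReal_le_ofReal (Real.rpow_le_rpow_of_exponent_le one_le_two ?_)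
        have h1 := h.osc_α v m x hx y hy
        have h2 : (v : ℝ) * (α x - α y) ≤ v * |α x - α y| := by gcongr; exact le_abs_self _
        linarith
      · rw [levelFun_eq, Pi.single_eq_of_ne, mul_zero, enorm_zero]
        · exact zero_le
        · intro h'
          exact hx (mem_dyadicCube_iff_cubeIdx.2 (Prod.ext_iff.1 h').2)
    · intro k hk
      rw [levelFun_eq, Pi.single_eq_of_ne, mul_zero, enorm_zero, ENNReal.zero_rpow_of_pos hq0]
      exact fun h' => hk (Prod.ext_iff.1 h').1
  refine (lintegral_mono hbound).trans ?_
  rw [lintegral_indicator (measurableSet_dyadicCube _ _), setLIntegral_const, volume_dyadicCube,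
    ← ENNReal.ofReal_mul (by positivity)]
  refine ENNReal.ofReal_le_ofReal (le_of_eq ?_)
  have : ((2 : ℝ) ^ (v : ℤ))⁻¹ ^ n = 2 ^ (-((v : ℝ) * n)) := by
    rw [zpow_natCast, Real.rpow_neg two_pos.le, inv_pow, ← pow_mul, ← Nat.cast_mul,
      Real.rpow_natCast]
  rw [this, mul_assoc, ← Real.rpow_add two_pos]
  congr 2
  ring

variable {n : ℕ} {α q : EuclideanSpace ℝ (Fin n) → ℝ} {hα : Measurable α} {hq : MemP q} {L R : ℝ}

/-- The unit sequence supported at the cube with index `i`, as an element of the `f`-space. -/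
noncomputable def unitSeq (h : ExponentControl α q L R) (i : Idx n) : FSpace α q hα hq :=
  ⟨Pi.single i 1, (fNorm_single_le h i.1 i.2 (cubeCorner_mem i)).trans_lt ENNReal.ofReal_lt_top⟩

theorem unitSeq_seq (h : ExponentControl α q L R) (i : Idx n) :
    (unitSeq h i : FSpace α q hα hq).seq = Pi.single i 1 := rfl

namespace FSpace

/-- `FSpace.seq` as a linear map. -/
noncomputable def seqLinear : FSpace α q hα hq →ₗ[ℂ] (Idx n → ℂ) := (fSubmodule α q hα hq).subtype

theorem seq_sum_smul_unitSeq (h : ExponentControl α q L R) (F : Finset (Idx n)) (c : Idx n → ℂ) :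
    (∑ i ∈ F, c i • (unitSeq h i : FSpace α q hα hq)).seq = (F : Set (Idx n)).indicator c := by
  have h1 : (∑ i ∈ F, c i • (unitSeq h i : FSpace α q hα hq)).seq =
      ∑ i ∈ F, c i • (unitSeq h i : FSpace α q hα hq).seq := by
    have := map_sum (seqLinear (hα := hα) (hq := hq)) (fun i => c i • unitSeq h i) F
    simp only [map_smul] at this
    exact this
  rw [h1]
  classical
  funext j
  simp only [unitSeq_seq, Finset.sum_apply, Pi.smul_apply, smul_eq_mul, Pi.single_apply,
    mul_ite, mul_one, mul_zero, Finset.sum_ite_eq, Set.indicator_apply, Finset.mem_coe]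

theorem seq_sub (s t : FSpace α q hα hq) : (s - t).seq = s.seq - t.seq := rfl

end FSpace

theorem enorm_levelFun_mono {s t : Idx n → ℂ} {v : ℕ} {x : EuclideanSpace ℝ (Fin n)}
    (h : ‖s (v, cubeIdx v x)‖ₑ ≤ ‖t (v, cubeIdx v x)‖ₑ) :
    ‖levelFun α s v x‖ₑ ≤ ‖levelFun α t v x‖ₑ := by
  rw [enorm_levelFun_eq_of_mem α s (mem_dyadicCube_cubeIdx v x),
    enorm_levelFun_eq_of_mem α t (mem_dyadicCube_cubeIdx v x)]
  gcongr

theorem tendsto_fNorm_sub_indicator (hα : Measurable α) (hq : Measurable q)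
    (hq1 : ∀ x, 1 < q x) {s : Idx n → ℂ} (hs : fNorm α q s < ∞) :
    Filter.Tendsto (fun F : Finset (Idx n) => fNorm α q ((F : Set (Idx n)).indicator s - s))
      Filter.atTop (nhds 0) := by
  have hle : ∀ (F : Finset (Idx n)) (i : Idx n),
      ‖((F : Set (Idx n)).indicator s - s) i‖ₑ ≤ ‖s i‖ₑ := by
    intro F i
    by_cases hi : i ∈ (F : Set (Idx n))
    · rw [Pi.sub_apply, Set.indicator_of_mem hi, sub_self, enorm_zero]; exact zero_le
    · rw [Pi.sub_apply, Set.indicator_of_notMem hi, zero_sub, enorm_neg]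
  have hq0 : ∀ x, 0 < q x := fun x => zero_lt_one.trans (hq1 x)
  have h0 : (0 : ℝ≥0∞) = ∫⁻ _ : EuclideanSpace ℝ (Fin n), 0 := by simp
  rw [h0]
  refine tendsto_lintegral_filter_of_dominated_convergence
    (fun x => (∑' v : ℕ, ‖levelFun α s v x‖ₑ ^ q x) ^ (1 / q x))
    (Filter.Eventually.of_forall fun F => measurable_inner hα hq _)
    (Filter.Eventually.of_forall fun F => Filter.Eventually.of_forall fun x => ?_) hs.ne ?_
  · refine ENNReal.rpow_le_rpow (ENNReal.tsum_le_tsum fun v => ?_) (by have := hq0 x; positivity)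
    exact ENNReal.rpow_le_rpow (enorm_levelFun_mono (hle F _)) (hq0 x).le
  · filter_upwards [ae_lt_top (measurable_inner hα hq s) hs.ne] with x hx
    have hfin : ∑' v : ℕ, ‖levelFun α s v x‖ₑ ^ q x ≠ ∞ := by
      intro htop
      rw [htop, ENNReal.top_rpow_of_pos (one_div_pos.2 (hq0 x))] at hx
      exact lt_irrefl _ hx
    have hlim : Filter.Tendsto (fun F : Finset (Idx n) =>
        ∑' v : ℕ, ‖levelFun α ((F : Set (Idx n)).indicator s - s) v x‖ₑ ^ q x)
        Filter.atTop (nhds 0) := by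
      have := tendsto_lintegral_filter_of_dominated_convergence
        (μ := (Measure.count : Measure ℕ)) (l := (Filter.atTop : Filter (Finset (Idx n))))
        (F := fun F v => ‖levelFun α ((F : Set (Idx n)).indicator s - s) v x‖ₑ ^ q x)
        (f := fun _ => 0) (fun v => ‖levelFun α s v x‖ₑ ^ q x)
        (Filter.Eventually.of_forall fun F => measurable_of_countable _)
        (Filter.Eventually.of_forall fun F => Filter.Eventually.of_forall fun v =>
          ENNReal.rpow_le_rpow (enorm_levelFun_mono (hle F _)) (hq0 x).le)
        (by rwa [lintegral_count])
        (Filter.Eventually.of_forall fun v => by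
          refine tendsto_const_nhds.congr' ?_
          filter_upwards [Filter.eventually_ge_atTop {(v, cubeIdx v x)}] with F hF
          have hmem : (v, cubeIdx (v : ℤ) x) ∈ (F : Set (Idx n)) := hF (Finset.mem_singleton_self _)
          rw [enorm_levelFun_eq_of_mem α _ (mem_dyadicCube_cubeIdx v x), Pi.sub_apply,
            Set.indicator_of_mem hmem, sub_self, enorm_zero, mul_zero,
            ENNReal.zero_rpow_of_pos (hq0 x)])
      simpa only [lintegral_count, lintegral_zero] using this
    have := (ENNReal.continuous_rpow_const (y := 1 / q x)).continuousAt.tendsto.comp hlim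
    rwa [ENNReal.zero_rpow_of_pos (one_div_pos.2 (hq0 x))] at this

/-- Every sequence of the `f`-space is the unconditional sum of its coordinates: as `q⁺ < ∞`, the
tails tend to zero by dominated convergence. -/
theorem hasSum_smul_unitSeq (h : ExponentControl α q L R) (s : FSpace α q hα hq) :
    HasSum (fun i => s.seq i • (unitSeq h i : FSpace α q hα hq)) s := by
  rw [HasSum, tendsto_iff_norm_sub_tendsto_zero, SummationFilter.unconditional_filter]
  have h1 := tendsto_fNorm_sub_indicator hα hq.measurable h.one_lt s.fNorm_lt_top
  have h2 := (ENNReal.tendsto_toReal ENNReal.zero_ne_top).comp h1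
  rw [ENNReal.toReal_zero] at h2
  refine h2.congr fun F => ?_
  rw [FSpace.norm_def, FSpace.seq_sub, FSpace.seq_sum_smul_unitSeq]
  rfl

/-! ### The functional of a sequence and the sequence of a functional -/

/-- A continuous functional is given by the pairing with the sequence of its conjugated values on
the unit sequences. -/
theorem hasSum_apply_unitSeq (h : ExponentControl α q L R)
    (T : StrongDual ℂ (FSpace α q hα hq)) (s : FSpace α q hα hq) :
    HasSum (fun i => s.seq i * conj (conj (T (unitSeq h i)))) (T s) := by
  have := (hasSum_smul_unitSeq h s).mapL T
  simpa only [map_smul, smul_eq_mul, Complex.conj_conj] using this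

theorem eq_conj_apply_unitSeq (h : ExponentControl α q L R)
    (T : StrongDual ℂ (FSpace α q hα hq)) {lam : Idx n → ℂ}
    (hT : ∀ s, HasSum (fun i => s.seq i * conj (lam i)) (T s)) :
    lam = fun i => conj (T (unitSeq h i)) := by
  funext i
  have h1 := hT (unitSeq h i)
  have h2 : HasSum (fun j => (unitSeq h i : FSpace α q hα hq).seq j * conj (lam j))
      (conj (lam i)) := by
    convert hasSum_single i ?_ using 1
    · rw [unitSeq_seq, Pi.single_eq_same, one_mul]
    · intro j hj
      rw [unitSeq_seq, Pi.single_eq_of_ne hj, zero_mul]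
  rw [h1.unique h2, Complex.conj_conj]

theorem exists_functional (h : ExponentControl α q L R) {lam : Idx n → ℂ}
    (hlam : bNorm (fun x => -α x) (conjExp q) (conjExp q) lam < ∞) :
    ∃ T : StrongDual ℂ (FSpace α q hα hq),
      (∀ s, HasSum (fun i => s.seq i * conj (lam i)) (T s)) ∧
      ‖T‖ₑ ≤ 4 * bNorm (fun x => -α x) (conjExp q) (conjExp q) lam := by
  set N := bNorm (fun x => -α x) (conjExp q) (conjExp q) lam with hN
  have hbound : ∀ s : FSpace α q hα hq,
      ∑' i, ‖s.seq i * conj (lam i)‖ₑ ≤ 4 * N * fNorm α q s.seq := by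
    intro s
    simp only [enorm_mul, RCLike.enorm_conj]
    -- The bound holds with any `μ > N` in place of `N`.
    have hlim : Filter.Tendsto (fun μ : ℝ≥0∞ => 4 * μ * fNorm α q s.seq) (nhdsWithin N (Set.Ioi N))
        (nhds (4 * N * fNorm α q s.seq)) := by
      refine Filter.Tendsto.mono_left ?_ nhdsWithin_le_nhds
      exact ((ENNReal.continuous_mul_const s.fNorm_lt_top.ne).comp
        (ENNReal.continuous_const_mul (by norm_num))).tendsto N
    have : (nhdsWithin N (Set.Ioi N)).NeBot := nhdsGT_neBot_of_exists_gt ⟨∞, hlam⟩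
    refine ge_of_tendsto hlim ?_
    filter_upwards [Ioo_mem_nhdsGT hlam] with μ hμ
    have hμ' : ENNReal.ofReal μ.toReal = μ := ENNReal.ofReal_toReal hμ.2.ne
    have := tsum_enorm_mul_enorm_le hα hq.measurable h.holderConjugate
      (ENNReal.toReal_pos (zero_le.trans_lt hμ.1).ne' hμ.2.ne) (hμ'.symm ▸ hμ.1) s.seq
    rwa [hμ'] at this
  have hfin : ∀ s : FSpace α q hα hq, 4 * N * fNorm α q s.seq ≠ ∞ := fun s =>
    ENNReal.mul_ne_top (ENNReal.mul_ne_top (by norm_num) hlam.ne) s.fNorm_lt_top.ne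
  have hsum : ∀ s : FSpace α q hα hq, Summable fun i => s.seq i * conj (lam i) := fun s =>
    Summable.of_enorm ((hbound s).trans_lt (hfin s).lt_top).ne
  let T₀ : FSpace α q hα hq →ₗ[ℂ] ℂ :=
    { toFun := fun s => ∑' i, s.seq i * conj (lam i)
      map_add' := fun s t => by
        rw [← (hsum s).tsum_add (hsum t)]
        refine tsum_congr fun i => ?_
        rw [← add_mul]
        rfl
      map_smul' := fun c s => by
        rw [RingHom.id_apply, smul_eq_mul, ← tsum_mul_left]
        refine tsum_congr fun i => ?_
        rw [← mul_assoc]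
        rfl }
  have hT₀ : ∀ s, ‖T₀ s‖ ≤ (4 * N).toReal * ‖s‖ := by
    intro s
    rw [FSpace.norm_def, ← ENNReal.toReal_mul, ← toReal_enorm]
    refine ENNReal.toReal_mono (hfin s) (le_trans ?_ (hbound s))
    exact enorm_tsum_le_tsum_enorm
  refine ⟨T₀.mkContinuous _ hT₀, fun s => (hsum s).hasSum, ?_⟩
  rw [← ofReal_norm]
  exact (ENNReal.ofReal_le_ofReal (T₀.mkContinuous_norm_le ENNReal.toReal_nonneg hT₀)).trans
    ENNReal.ofReal_toReal_le

/-! ### Comparison of the weights on a cube with their values at the corner -/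

theorem rpow_le_rpow_of_oscillation {v : ℕ} {w a b L : ℝ} (h1 : ((2 : ℝ) ^ v)⁻¹ ≤ w) (h2 : w ≤ 1)
    (h : v * |a - b| ≤ L) : w ^ a ≤ 2 ^ L * w ^ b := by
  have hv : 0 < ((2 : ℝ) ^ v)⁻¹ := by positivity
  have hw : 0 < w := hv.trans_le h1
  have key : w ^ (a - b) ≤ 2 ^ L := calc
    w ^ (a - b) ≤ w ^ (-|a - b|) := Real.rpow_le_rpow_of_exponent_ge hw h2 (neg_abs_le _)
    _ ≤ (((2 : ℝ) ^ v)⁻¹) ^ (-|a - b|) :=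
      Real.rpow_le_rpow_of_nonpos hv h1 (neg_nonpos.2 (abs_nonneg _))
    _ = 2 ^ (v * |a - b|) := by
      rw [Real.rpow_neg hv.le, Real.inv_rpow (by positivity), inv_inv, ← Real.rpow_natCast,
        ← Real.rpow_mul two_pos.le]
    _ ≤ 2 ^ L := Real.rpow_le_rpow_of_exponent_le one_le_two h
  rw [Real.rpow_sub hw, div_le_iff₀ (Real.rpow_pos_of_pos hw b)] at key
  exact key

/-- The size `2^{v(-α + n/2)} |lam_{v,m}|` of a coefficient, with `α` evaluated at the corner of
the cube. -/
noncomputable def coeffSize {n : ℕ} (α : EuclideanSpace ℝ (Fin n) → ℝ) (lam : Idx n → ℂ)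
    (i : Idx n) : ℝ :=
  2 ^ ((i.1 : ℝ) * (-α (cubeCorner i) + (n : ℝ) / 2)) * ‖lam i‖

/-- A cube is significant if its coefficient is larger than its side length; on such cubes a
power of the coefficient is insensitive, up to a fixed factor, to the oscillation of the exponent. -/
def Significant {n : ℕ} (α : EuclideanSpace ℝ (Fin n) → ℝ) (lam : Idx n → ℂ) (i : Idx n) : Prop :=
  ((2 : ℝ) ^ i.1)⁻¹ < coeffSize α lam i

theorem coeffSize_nonneg (α : EuclideanSpace ℝ (Fin n) → ℝ) (lam : Idx n → ℂ) (i : Idx n) :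
    0 ≤ coeffSize α lam i := by unfold coeffSize; positivity

theorem enorm_levelFun_le_coeffSize (h : ExponentControl α q L R) (lam : Idx n → ℂ) {v : ℕ}
    {m : Fin n → ℤ} {x : EuclideanSpace ℝ (Fin n)} (hx : x ∈ dyadicCube (v : ℤ) m) :
    ‖levelFun (fun x => -α x) lam v x‖ₑ ≤ ENNReal.ofReal (2 ^ L * coeffSize α lam (v, m)) := by
  rw [enorm_levelFun_eq_of_mem _ lam hx, ← ofReal_norm, ← ENNReal.ofReal_mul (by positivity),
    coeffSize, ← mul_assoc, ← Real.rpow_add two_pos]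
  refine ENNReal.ofReal_le_ofReal (mul_le_mul_of_nonneg_right ?_ (norm_nonneg _))
  refine Real.rpow_le_rpow_of_exponent_le one_le_two ?_
  have h1 := h.osc_α v m x hx _ (cubeCorner_mem (v, m))
  have h2 : (v : ℝ) * -(α x - α (cubeCorner (v, m))) ≤ v * |α x - α (cubeCorner (v, m))| := by
    gcongr; exact neg_le_abs _
  dsimp only
  linarith

/-- A coefficient of size at most `1` contributes either its power with the exponent frozen at the
corner or, on an insignificant cube, at most the side length. -/
theorem enorm_levelFun_rpow_le (h : ExponentControl α q L R) {lam : Idx n → ℂ} {v : ℕ}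
    {m : Fin n → ℤ} (hle : coeffSize α lam (v, m) ≤ 1) {x : EuclideanSpace ℝ (Fin n)}
    (hx : x ∈ dyadicCube (v : ℤ) m) :
    ‖levelFun (fun x => -α x) lam v x‖ₑ ^ conjExp q x ≤ ENNReal.ofReal (2 ^ (L * R + L)) *
      ({i | Significant α lam i}.indicator (fun i => ENNReal.ofReal
        (coeffSize α lam i ^ conjExp q (cubeCorner i))) (v, m) + 2⁻¹ ^ v) := by
  set w := coeffSize α lam (v, m) with hw
  have hw0 : 0 ≤ w := coeffSize_nonneg _ _ _
  have hr1 := h.one_lt_conj x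
  have hr0 : 0 ≤ conjExp q x := zero_le_one.trans hr1.le
  have hLR : ((2 : ℝ) ^ L) ^ conjExp q x ≤ 2 ^ (L * R) := by
    rw [← Real.rpow_mul two_pos.le]
    exact Real.rpow_le_rpow_of_exponent_le one_le_two
      (mul_le_mul_of_nonneg_left (h.conj_le x) h.L_nonneg)
  have h2L : (1 : ℝ) ≤ 2 ^ L := Real.one_le_rpow one_le_two h.L_nonneg
  calc ‖levelFun (fun x => -α x) lam v x‖ₑ ^ conjExp q x
      ≤ ENNReal.ofReal (2 ^ L * w) ^ conjExp q x := by
        gcongr; exact enorm_levelFun_le_coeffSize h lam hx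
    _ = ENNReal.ofReal ((2 ^ L) ^ conjExp q x * w ^ conjExp q x) := by
        rw [ENNReal.ofReal_rpow_of_nonneg (by positivity) hr0, Real.mul_rpow (by positivity) hw0]
    _ ≤ ENNReal.ofReal (2 ^ (L * R) * w ^ conjExp q x) := by gcongr
    _ ≤ _ := by
      rw [Real.rpow_add two_pos]
      by_cases hsig : (v, m) ∈ {i | Significant α lam i}
      · rw [Set.indicator_of_mem hsig]
        refine le_trans ?_ (mul_le_mul_right le_self_add _)
        rw [← ENNReal.ofReal_mul (by positivity), mul_assoc]
        gcongr
        exact rpow_le_rpow_of_oscillation (le_of_lt hsig) hle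
          (h.osc_conj v m x hx _ (cubeCorner_mem (v, m)))
      · rw [Set.indicator_of_notMem hsig, zero_add]
        have hsmall : w ≤ ((2 : ℝ) ^ v)⁻¹ := not_lt.1 hsig
        have hpow : w ^ conjExp q x ≤ ((2 : ℝ) ^ v)⁻¹ := by
          calc w ^ conjExp q x ≤ w ^ (1 : ℝ) := by
                rcases hw0.eq_or_lt with h0 | h0
                · rw [← h0, Real.zero_rpow (by linarith), Real.zero_rpow one_ne_zero]
                · exact Real.rpow_le_rpow_of_exponent_ge h0 hle hr1.le
            _ = w := Real.rpow_one w
            _ ≤ _ := hsmall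
        have hcast : (2⁻¹ : ℝ≥0∞) ^ v = ENNReal.ofReal ((2 : ℝ) ^ v)⁻¹ := by
          rw [← inv_pow, ENNReal.ofReal_pow (by positivity), ENNReal.ofReal_inv_of_pos two_pos,
            ENNReal.ofReal_ofNat]
        rw [hcast, ← ENNReal.ofReal_mul (by positivity)]
        refine ENNReal.ofReal_le_ofReal ?_
        have : (0 : ℝ) < 2 ^ (L * R) := by positivity
        calc (2 : ℝ) ^ (L * R) * w ^ conjExp q x ≤ 2 ^ (L * R) * ((2 : ℝ) ^ v)⁻¹ := by gcongr
          _ ≤ 2 ^ (L * R) * 2 ^ L * ((2 : ℝ) ^ v)⁻¹ := by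
            gcongr; exact le_mul_of_one_le_right this.le h2L

/-! ### Test sequences -/

/-- For a sequence supported in cubes inside `P`, the `f`-norm is controlled by the measure of `P`
and the modular, since `t^{1/q} ≤ 1 + t`. -/
theorem fNorm_le_of_forall_subset (hα : Measurable α) (hq : Measurable q) (hq1 : ∀ x, 1 < q x)
    {P : Set (EuclideanSpace ℝ (Fin n))} (hP : MeasurableSet P) {s : Idx n → ℂ}
    (hs : ∀ i, s i ≠ 0 → dyadicCube (i.1 : ℤ) i.2 ⊆ P) :
    fNorm α q s ≤ volume P +
      ∑' i : Idx n, ∫⁻ x in dyadicCube (i.1 : ℤ) i.2, ‖levelFun α s i.1 x‖ₑ ^ q x := by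
  have hpt : ∀ x, (∑' v : ℕ, ‖levelFun α s v x‖ₑ ^ q x) ^ (1 / q x) ≤
      P.indicator 1 x + ∑' v : ℕ, ‖levelFun α s v x‖ₑ ^ q x := by
    intro x
    have hq0 : 0 < q x := zero_lt_one.trans (hq1 x)
    by_cases hx : x ∈ P
    · rw [Set.indicator_of_mem hx, Pi.one_apply]
      set t := ∑' v : ℕ, ‖levelFun α s v x‖ₑ ^ q x
      rcases le_total t 1 with ht | ht
      · exact (ENNReal.rpow_le_one ht (one_div_nonneg.2 hq0.le)).trans le_self_add
      · refine le_trans ?_ le_add_self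
        calc t ^ (1 / q x) ≤ t ^ (1 : ℝ) := by
              refine ENNReal.rpow_le_rpow_of_exponent_le ht ?_
              exact (div_le_one hq0).2 (hq1 x).le
          _ = t := ENNReal.rpow_one t
    · have h0 : ∀ v : ℕ, ‖levelFun α s v x‖ₑ ^ q x = 0 := by
        intro v
        have : s (v, cubeIdx (v : ℤ) x) = 0 := by
          by_contra hne
          exact hx (hs _ hne (mem_dyadicCube_cubeIdx _ x))
        rw [enorm_levelFun_eq_of_mem α s (mem_dyadicCube_cubeIdx v x), this, enorm_zero, mul_zero,
          ENNReal.zero_rpow_of_pos hq0]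
      simp only [h0, tsum_zero]
      rw [ENNReal.zero_rpow_of_pos (one_div_pos.2 hq0)]
      exact zero_le
  have hmeas : ∀ v : ℕ, Measurable fun x => ‖levelFun α s v x‖ₑ ^ q x := fun v =>
    (measurable_levelFun hα s v).enorm.pow hq
  calc fNorm α q s ≤ ∫⁻ x, (P.indicator 1 x + ∑' v : ℕ, ‖levelFun α s v x‖ₑ ^ q x) :=
        lintegral_mono hpt
    _ = volume P + ∑' v : ℕ, ∫⁻ x, ‖levelFun α s v x‖ₑ ^ q x := by
        rw [lintegral_add_left (measurable_one.indicator hP), lintegral_indicator_one hP,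
          lintegral_tsum fun v => (hmeas v).aemeasurable]
    _ = volume P + ∑' (v : ℕ) (m : Fin n → ℤ),
          ∫⁻ x in dyadicCube (v : ℤ) m, ‖levelFun α s v x‖ₑ ^ q x := by
        congr 1
        exact tsum_congr fun v => lintegral_eq_tsum_dyadicCube (v : ℤ) _ _
    _ = _ := by
        rw [← ENNReal.tsum_prod (f := fun (v : ℕ) (m : Fin n → ℤ) =>
          ∫⁻ x in dyadicCube (v : ℤ) m, ‖levelFun α s v x‖ₑ ^ q x)]

/-- The coefficients of the sequence on which a functional is tested in order to recover the sum of
the powers of its own coefficients. -/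
noncomputable def testCoeff (α q : EuclideanSpace ℝ (Fin n) → ℝ) (lam : Idx n → ℂ)
    (i : Idx n) : ℂ :=
  lam i / (‖lam i‖ : ℂ) * (((2 : ℝ) ^ (-((i.1 : ℝ) * (α (cubeCorner i) + (n : ℝ) / 2))) *
    coeffSize α lam i ^ (conjExp q (cubeCorner i) - 1) : ℝ) : ℂ)

theorem testCoeff_mul_conj {lam : Idx n → ℂ} {i : Idx n} (hi : 0 < coeffSize α lam i) :
    testCoeff α q lam i * conj (lam i) =
      ((volume.real (dyadicCube (i.1 : ℤ) i.2) *
        coeffSize α lam i ^ conjExp q (cubeCorner i) : ℝ) : ℂ) := by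
  have hne : ‖lam i‖ ≠ 0 := fun h0 => by simp [coeffSize, h0] at hi
  have h1 : lam i / (‖lam i‖ : ℂ) * conj (lam i) = (‖lam i‖ : ℂ) := by
    rw [div_mul_eq_mul_div, Complex.mul_conj', sq, mul_div_assoc, div_self (by exact_mod_cast hne),
      mul_one]
  have h2 : volume.real (dyadicCube (i.1 : ℤ) i.2) = (2 : ℝ) ^ (-((i.1 : ℝ) * n)) := by
    rw [Measure.real, volume_dyadicCube, ENNReal.toReal_ofReal (by positivity), zpow_natCast,
      Real.rpow_neg two_pos.le, inv_pow, ← pow_mul, ← Nat.cast_mul, Real.rpow_natCast]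
  rw [testCoeff, mul_right_comm, h1, ← Complex.ofReal_mul, h2]
  congr 1
  rw [Real.rpow_sub_one hi.ne']
  have h3 : (2 : ℝ) ^ (-((i.1 : ℝ) * n)) * coeffSize α lam i =
      2 ^ (-((i.1 : ℝ) * (α (cubeCorner i) + (n : ℝ) / 2))) * ‖lam i‖ := by
    rw [coeffSize, ← mul_assoc, ← Real.rpow_add two_pos]
    congr 2
    ring
  rw [← mul_div_assoc, ← mul_div_assoc, div_eq_iff hi.ne']
  linear_combination (-coeffSize α lam i ^ conjExp q (cubeCorner i)) * h3

/-- Since `(q' - 1) q = q'`, the `q`-th powers of the test sequence are the `q'`-th powers of the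
coefficients, up to the oscillation of the exponents. -/
theorem enorm_levelFun_testCoeff_rpow_le (h : ExponentControl α q L R) {lam : Idx n → ℂ}
    {s : Idx n → ℂ} {v : ℕ} {m : Fin n → ℤ} (hs : s (v, m) = testCoeff α q lam (v, m))
    (hsig : Significant α lam (v, m)) (hle : coeffSize α lam (v, m) ≤ 1)
    {x : EuclideanSpace ℝ (Fin n)} (hx : x ∈ dyadicCube (v : ℤ) m) :
    ‖levelFun α s v x‖ₑ ^ q x ≤ ENNReal.ofReal (2 ^ (L * R + L * R) *
      coeffSize α lam (v, m) ^ conjExp q (cubeCorner (v, m))) := by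
  set w := coeffSize α lam (v, m) with hw
  set y := cubeCorner (v, m) with hy
  have hym : y ∈ dyadicCube (v : ℤ) m := cubeCorner_mem (v, m)
  have hw0 : 0 < w := lt_trans (by positivity) hsig
  have hne : ‖lam (v, m)‖ ≠ 0 := fun h0 => by simp [hw, coeffSize, h0] at hw0
  have hq0 : 0 ≤ q x := zero_le_one.trans (h.one_lt x).le
  have hr1 : 0 ≤ conjExp q y - 1 := sub_nonneg.2 (h.one_lt_conj y).le
  have hnorm : ‖testCoeff α q lam (v, m)‖ =
      2 ^ (-((v : ℝ) * (α y + (n : ℝ) / 2))) * w ^ (conjExp q y - 1) := by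
    rw [testCoeff, norm_mul, norm_div, Complex.norm_real, Complex.norm_real, norm_norm,
      div_self hne, one_mul, Real.norm_of_nonneg (by positivity)]
  have hlevel : ‖levelFun α s v x‖ₑ ≤ ENNReal.ofReal (2 ^ L * w ^ (conjExp q y - 1)) := by
    rw [enorm_levelFun_eq_of_mem α s hx, hs, ← ofReal_norm, hnorm,
      ← ENNReal.ofReal_mul (by positivity), ← mul_assoc, ← Real.rpow_add two_pos]
    gcongr
    · exact one_le_two
    · have h1 := h.osc_α v m x hx y hym
      have h2 : (v : ℝ) * (α x - α y) ≤ v * |α x - α y| := by gcongr; exact le_abs_self _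
      linarith
  refine (ENNReal.rpow_le_rpow hlevel hq0).trans ?_
  rw [ENNReal.ofReal_rpow_of_nonneg (by positivity) hq0, Real.mul_rpow (by positivity)
    (by positivity), ← Real.rpow_mul hw0.le, ← Real.rpow_mul two_pos.le, Real.rpow_add two_pos,
    mul_assoc]
  gcongr
  · exact one_le_two
  · exact h.L_nonneg
  · exact h.le x
  · have hexp : conjExp q y = (conjExp q y - 1) * q y := by
      have := (h.holderConjugate y).mul_eq_add
      linarith
    refine rpow_le_rpow_of_oscillation hsig.le hle ?_
    nth_rw 2 [hexp]
    rw [← mul_sub, abs_mul, abs_of_nonneg hr1, mul_left_comm, mul_comm L R]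
    have := h.osc v m x hx y hym
    have := h.conj_le y
    have := h.one_le_R
    gcongr
    linarith

/-! ### The coefficients of a functional satisfy the Carleson condition -/

theorem coeffSize_le_one (h : ExponentControl α q L R) (T : StrongDual ℂ (FSpace α q hα hq))
    (hT : ‖T‖ * 2 ^ L ≤ 1) (i : Idx n) :
    coeffSize α (fun i => conj (T (unitSeq h i))) i ≤ 1 := by
  have h1 : ‖(unitSeq h i : FSpace α q hα hq)‖ ≤
      2 ^ L * 2 ^ ((i.1 : ℝ) * (α (cubeCorner i) - (n : ℝ) / 2)) :=
    ENNReal.toReal_le_of_le_ofReal (by positivity) (fNorm_single_le h i.1 i.2 (cubeCorner_mem i))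
  have h2 : ‖T (unitSeq h i)‖ ≤ 2 ^ ((i.1 : ℝ) * (α (cubeCorner i) - (n : ℝ) / 2)) := calc
    ‖T (unitSeq h i)‖ ≤ ‖T‖ * (2 ^ L * 2 ^ ((i.1 : ℝ) * (α (cubeCorner i) - (n : ℝ) / 2))) :=
      (T.le_opNorm _).trans (by gcongr)
    _ ≤ 1 * 2 ^ ((i.1 : ℝ) * (α (cubeCorner i) - (n : ℝ) / 2)) := by
      rw [← mul_assoc]; gcongr
    _ = _ := one_mul _
  rw [coeffSize, RCLike.norm_conj]
  calc _ ≤ (2 : ℝ) ^ ((i.1 : ℝ) * (-α (cubeCorner i) + (n : ℝ) / 2)) *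
        2 ^ ((i.1 : ℝ) * (α (cubeCorner i) - (n : ℝ) / 2)) := by gcongr
    _ = 1 := by
      rw [← Real.rpow_add two_pos, ← Real.rpow_zero 2]
      congr 1
      ring

/-- Testing a functional of small norm on the significant cubes inside `P`: with `I` the sum on the
left, one gets `I ≤ ‖T‖ (|P| + 2^{2LR} I)`, and the last term is absorbed. -/
theorem sum_volume_mul_coeffSize_le (h : ExponentControl α q L R)
    (T : StrongDual ℂ (FSpace α q hα hq)) (hT : ‖T‖ * (2 * 2 ^ (L * R + L * R)) ≤ 1)
    {lam : Idx n → ℂ} (hlam : lam = fun i => conj (T (unitSeq h i)))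
    (hle : ∀ i, coeffSize α lam i ≤ 1)
    {J : ℤ} {M : Fin n → ℤ} (F : Finset (Idx n))
    (hF : ∀ i ∈ F, dyadicCube (i.1 : ℤ) i.2 ⊆ dyadicCube J M ∧ Significant α lam i) :
    ∑ i ∈ F, volume.real (dyadicCube (i.1 : ℤ) i.2) *
      coeffSize α lam i ^ conjExp q (cubeCorner i) ≤ volume.real (dyadicCube J M) := by
  set K : ℝ := 2 ^ (L * R + L * R) with hK
  set P := dyadicCube J M with hP
  set I := ∑ i ∈ F, volume.real (dyadicCube (i.1 : ℤ) i.2) *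
      coeffSize α lam i ^ conjExp q (cubeCorner i) with hI
  have hI0 : 0 ≤ I := Finset.sum_nonneg fun i _ =>
    mul_nonneg measureReal_nonneg (Real.rpow_nonneg (coeffSize_nonneg _ _ _) _)
  have hK1 : 1 ≤ K := Real.one_le_rpow one_le_two
    (by have := h.L_nonneg; have := h.one_le_R; positivity)
  set s : FSpace α q hα hq := ∑ i ∈ F, testCoeff α q lam i • unitSeq h i with hs
  have hseq : s.seq = (F : Set (Idx n)).indicator (testCoeff α q lam) :=
    FSpace.seq_sum_smul_unitSeq h F _
  have hTs : T s = (I : ℂ) := by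
    rw [hs, map_sum, hI, Complex.ofReal_sum]
    refine Finset.sum_congr rfl fun i hi => ?_
    have hpos : 0 < coeffSize α lam i := lt_trans (by positivity) (hF i hi).2
    rw [map_smul, smul_eq_mul, ← testCoeff_mul_conj hpos]
    congr 1
    rw [hlam, Complex.conj_conj]
  have hfN : fNorm α q s.seq ≤ ENNReal.ofReal (volume.real P + K * I) := by
    refine (fNorm_le_of_forall_subset hα hq.measurable h.one_lt (measurableSet_dyadicCube J M)
      (s := s.seq) ?_).trans ?_
    · intro i hi
      rw [hseq] at hi
      exact (hF i (Set.mem_of_indicator_ne_zero hi)).1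
    · rw [ENNReal.ofReal_add measureReal_nonneg (by positivity), Measure.real,
        ENNReal.ofReal_toReal (volume_dyadicCube_ne_top J M)]
      gcongr
      have hterm : ∀ i : Idx n, ∫⁻ x in dyadicCube (i.1 : ℤ) i.2, ‖levelFun α s.seq i.1 x‖ₑ ^ q x ≤
          (F : Set (Idx n)).indicator (fun i => ENNReal.ofReal
            (K * (volume.real (dyadicCube (i.1 : ℤ) i.2) *
              coeffSize α lam i ^ conjExp q (cubeCorner i)))) i := by
        rintro ⟨v, m⟩
        have hcw : 0 ≤ coeffSize α lam (v, m) := coeffSize_nonneg _ _ _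
        by_cases hi : (v, m) ∈ (F : Set (Idx n))
        · rw [Set.indicator_of_mem hi]
          calc ∫⁻ x in dyadicCube (v : ℤ) m, ‖levelFun α s.seq v x‖ₑ ^ q x
              ≤ ∫⁻ x in dyadicCube (v : ℤ) m, ENNReal.ofReal (K *
                coeffSize α lam (v, m) ^ conjExp q (cubeCorner (v, m))) :=
                setLIntegral_mono measurable_const fun x hx =>
                  enorm_levelFun_testCoeff_rpow_le h (by rw [hseq, Set.indicator_of_mem hi])
                    (hF _ hi).2 (hle _) hx
            _ = _ := by
                rw [setLIntegral_const, ← ENNReal.ofReal_toReal (volume_dyadicCube_ne_top _ _),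
                  ← ENNReal.ofReal_mul (by positivity), Measure.real]
                congr 1
                ring
        · rw [Set.indicator_of_notMem hi, nonpos_iff_eq_zero]
          rw [← lintegral_zero (μ := volume.restrict (dyadicCube (v : ℤ) m))]
          refine setLIntegral_congr_fun (measurableSet_dyadicCube _ _) fun x hx => ?_
          dsimp only
          rw [enorm_levelFun_eq_of_mem α _ hx, hseq, Set.indicator_of_notMem hi, enorm_zero,
            mul_zero, ENNReal.zero_rpow_of_pos (zero_lt_one.trans (h.one_lt x))]
      refine (ENNReal.tsum_le_tsum hterm).trans (le_of_eq ?_)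
      rw [← sum_eq_tsum_indicator, hI, Finset.mul_sum, ENNReal.ofReal_sum_of_nonneg]
      intro i _
      have := coeffSize_nonneg α lam i
      positivity
  have hnorm : ‖s‖ ≤ volume.real P + K * I := by
    rw [FSpace.norm_def]
    exact ENNReal.toReal_le_of_le_ofReal (by positivity) hfN
  have hfinal : I ≤ ‖T‖ * (volume.real P + K * I) := by
    calc I = ‖T s‖ := by rw [hTs, Complex.norm_real, Real.norm_of_nonneg hI0]
      _ ≤ ‖T‖ * ‖s‖ := T.le_opNorm s
      _ ≤ _ := by gcongr
  have hT0 := norm_nonneg T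
  have hv0 : 0 ≤ volume.real P := measureReal_nonneg
  have hTK : ‖T‖ * K ≤ 1 / 2 := by linarith
  have hT2 : ‖T‖ ≤ 1 / 2 := (le_mul_of_one_le_right hT0 hK1).trans hTK
  nlinarith

theorem tsum_lintegral_le_of_norm_le (h : ExponentControl α q L R)
    (T : StrongDual ℂ (FSpace α q hα hq)) (hT : ‖T‖ * (2 * 2 ^ (L * R + L * R)) ≤ 1)
    (J : ℤ) (M : Fin n → ℤ) :
    ∑' v : {v : ℕ // max J 0 ≤ (v : ℤ)}, ∫⁻ x in dyadicCube J M,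
      ‖levelFun (fun x => -α x) (fun i => conj (T (unitSeq h i))) v x‖ₑ ^ conjExp q x ≤
      ENNReal.ofReal (3 * 2 ^ (L * R + L)) * volume (dyadicCube J M) := by
  classical
  set lam : Idx n → ℂ := fun i => conj (T (unitSeq h i)) with hlam
  set P := dyadicCube J M with hP
  have hle : ∀ i, coeffSize α lam i ≤ 1 := by
    refine coeffSize_le_one h T (le_trans ?_ hT)
    gcongr
    have h1 : (2 : ℝ) ^ L ≤ 2 ^ (L * R + L * R) := by
      refine Real.rpow_le_rpow_of_exponent_le one_le_two ?_
      have := h.L_nonneg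
      have := h.one_le_R
      nlinarith
    have : (0 : ℝ) < 2 ^ L := by positivity
    linarith
  set g : Idx n → ℝ≥0∞ := {i | Significant α lam i}.indicator
    (fun i => ENNReal.ofReal (coeffSize α lam i ^ conjExp q (cubeCorner i))) with hg
  set A : Set (Idx n) := {i | dyadicCube (i.1 : ℤ) i.2 ⊆ P ∧ Significant α lam i} with hA
  set G : Idx n → ℝ≥0∞ := A.indicator (fun i => ENNReal.ofReal
    (volume.real (dyadicCube (i.1 : ℤ) i.2) * coeffSize α lam i ^ conjExp q (cubeCorner i))) with hG
  have hGsum : ∑' i, G i ≤ volume P := by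
    rw [ENNReal.tsum_eq_iSup_sum]
    refine iSup_le fun F => ?_
    rw [hG, Finset.sum_indicator_eq_sum_filter, ← ENNReal.ofReal_sum_of_nonneg
      fun i _ => mul_nonneg measureReal_nonneg (Real.rpow_nonneg (coeffSize_nonneg _ _ _) _)]
    refine (ENNReal.ofReal_le_ofReal (sum_volume_mul_coeffSize_le h T hT hlam hle (J := J) (M := M)
      _ fun i hi => (Finset.mem_filter.1 hi).2)).trans ?_
    rw [Measure.real]
    exact ENNReal.ofReal_toReal_le
  have hlevel : ∀ v : {v : ℕ // max J 0 ≤ (v : ℤ)},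
      ∫⁻ x in P, ‖levelFun (fun x => -α x) lam v x‖ₑ ^ conjExp q x ≤
        ENNReal.ofReal (2 ^ (L * R + L)) *
          (∑' m, G ((v : ℕ), m) + 2⁻¹ ^ (v : ℕ) * volume P) := by
    rintro ⟨v, hv⟩
    have hgm : Measurable fun x : EuclideanSpace ℝ (Fin n) => g (v, cubeIdx (v : ℤ) x) :=
      (measurable_of_countable fun m => g (v, m)).comp (measurable_cubeIdx (v : ℤ))
    calc ∫⁻ x in P, ‖levelFun (fun x => -α x) lam v x‖ₑ ^ conjExp q x
        ≤ ∫⁻ x in P, ENNReal.ofReal (2 ^ (L * R + L)) * (g (v, cubeIdx (v : ℤ) x) + 2⁻¹ ^ v) :=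
          lintegral_mono fun x =>
            enorm_levelFun_rpow_le h (hle _) (mem_dyadicCube_cubeIdx (v : ℤ) x)
      _ = ENNReal.ofReal (2 ^ (L * R + L)) *
            ((∫⁻ x in P, g (v, cubeIdx (v : ℤ) x)) + 2⁻¹ ^ v * volume P) := by
          rw [lintegral_const_mul _ (hgm.add_const _), lintegral_add_left hgm, setLIntegral_const]
      _ ≤ _ := by
          gcongr
          rw [lintegral_eq_tsum_dyadicCube (v : ℤ)]
          refine ENNReal.tsum_le_tsum fun m => ?_
          rw [setLIntegral_congr_fun (g := fun _ => g (v, m)) (measurableSet_dyadicCube _ _)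
            (fun x hx => by dsimp only; rw [mem_dyadicCube_iff_cubeIdx.1 hx]),
            setLIntegral_const, Measure.restrict_apply (measurableSet_dyadicCube _ _)]
          rcases (dyadicCube (v : ℤ) m ∩ P).eq_empty_or_nonempty with he | ⟨x, hxm, hxP⟩
          · rw [he, measure_empty, mul_zero]; exact zero_le
          · have hsub := dyadicCube_subset_of_mem ((le_max_left J 0).trans hv) hxm hxP
            by_cases hsig : Significant α lam (v, m)
            · have h1 : (v, m) ∈ A := ⟨hsub, hsig⟩
              have h2 : (v, m) ∈ {i | Significant α lam i} := hsig
              have hw := coeffSize_nonneg α lam (v, m)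
              rw [hg, hG, Set.indicator_of_mem h1, Set.indicator_of_mem h2, mul_comm,
                ENNReal.ofReal_mul measureReal_nonneg, Measure.real,
                ENNReal.ofReal_toReal (volume_dyadicCube_ne_top _ _)]
              gcongr
              exact Set.inter_subset_left
            · have h2 : (v, m) ∉ {i | Significant α lam i} := hsig
              rw [hg, Set.indicator_of_notMem h2, zero_mul]
              exact zero_le
  calc _ ≤ ∑' v : {v : ℕ // max J 0 ≤ (v : ℤ)}, ENNReal.ofReal (2 ^ (L * R + L)) *
          (∑' m, G ((v : ℕ), m) + 2⁻¹ ^ (v : ℕ) * volume P) := ENNReal.tsum_le_tsum hlevel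
    _ ≤ ∑' v : ℕ, ENNReal.ofReal (2 ^ (L * R + L)) *
          (∑' m, G (v, m) + 2⁻¹ ^ v * volume P) :=
        ENNReal.tsum_comp_le_tsum_of_injective Subtype.val_injective
          (fun v : ℕ => ENNReal.ofReal (2 ^ (L * R + L)) * (∑' m, G (v, m) + 2⁻¹ ^ v * volume P))
    _ = ENNReal.ofReal (2 ^ (L * R + L)) * (∑' i, G i + 2 * volume P) := by
        rw [ENNReal.tsum_mul_left, ENNReal.tsum_add, ENNReal.tsum_mul_right,
          ENNReal.tsum_geometric_two, ← ENNReal.tsum_prod (f := fun v m => G (v, m))]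
    _ ≤ ENNReal.ofReal (2 ^ (L * R + L)) * (volume P + 2 * volume P) := by gcongr
    _ = _ := by
        rw [ENNReal.ofReal_mul (by norm_num), ENNReal.ofReal_ofNat]
        ring

/-- The `b̃`-norm of the coefficients of a functional is bounded by its operator norm. -/
theorem bNorm_conj_apply_unitSeq_le (h : ExponentControl α q L R)
    (T : StrongDual ℂ (FSpace α q hα hq)) :
    bNorm (fun x => -α x) (conjExp q) (conjExp q) (fun i => conj (T (unitSeq h i))) ≤
      ENNReal.ofReal (3 * 2 ^ (L * R + L) * (2 * 2 ^ (L * R + L * R))) * ‖T‖ₑ := by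
  set H : ℝ := 3 * 2 ^ (L * R + L) with hH
  set D : ℝ := 2 * 2 ^ (L * R + L * R) with hD
  have hD0 : 0 < D := by positivity
  have hH1 : 1 ≤ H := by
    have : (1 : ℝ) ≤ 2 ^ (L * R + L) := Real.one_le_rpow one_le_two
      (by have := h.L_nonneg; have := h.one_le_R; positivity)
    linarith
  have hH0 : 0 < H := zero_lt_one.trans_le hH1
  have hr0 : ∀ x, 0 < conjExp q x := fun x => zero_lt_one.trans (h.one_lt_conj x)
  have key : ∀ t : ℝ, ‖T‖ < t →
      bNorm (fun x => -α x) (conjExp q) (conjExp q) (fun i => conj (T (unitSeq h i))) ≤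
        ENNReal.ofReal (H * D * t) := by
    intro t ht
    have ht0 : 0 < t := (norm_nonneg T).trans_lt ht
    -- The functional is rescaled to have norm at most `1 / D`.
    set c : ℝ := (D * t)⁻¹ with hc
    have hc0 : 0 < c := by positivity
    have hcT : ‖(c : ℂ) • T‖ * D ≤ 1 := by
      rw [norm_smul, Complex.norm_real, Real.norm_of_nonneg hc0.le]
      have : c * D * t = 1 := by rw [hc]; field_simp
      nlinarith [mul_pos hc0 hD0]
    refine bNorm_le_of_cubeModular_le hr0 (by positivity) fun J M => ?_
    have hmain := tsum_lintegral_le_of_norm_le h ((c : ℂ) • T) hcT J M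
    have hstep : cubeModular (fun x => -α x) (conjExp q) (fun i => conj (T (unitSeq h i)))
        (H * D * t) J M ≤ (ENNReal.ofReal H)⁻¹ * ∑' v : {v : ℕ // max J 0 ≤ (v : ℤ)},
        ∫⁻ x in dyadicCube J M, ‖levelFun (fun x => -α x)
          (fun i => conj (((c : ℂ) • T) (unitSeq h i))) v x‖ₑ ^ conjExp q x := by
      rw [← ENNReal.tsum_mul_left]
      refine ENNReal.tsum_le_tsum fun v => ?_
      rw [← lintegral_const_mul' _ _ (ENNReal.inv_ne_top.2 (by simpa using hH0))]
      refine lintegral_mono fun x => ?_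
      have hsc : levelFun (fun x => -α x) (fun i => conj (((c : ℂ) • T) (unitSeq h i))) v x =
          (c : ℂ) * levelFun (fun x => -α x) (fun i => conj (T (unitSeq h i))) v x := by
        rw [levelFun_eq, levelFun_eq]
        simp only [smul_apply, smul_eq_mul, map_mul, Complex.conj_ofReal]
        ring
      have hcn : ‖(c : ℂ)‖ₑ = ENNReal.ofReal c := by
        rw [← ofReal_norm, Complex.norm_real, Real.norm_of_nonneg hc0.le]
      have hdiv : ‖levelFun (fun x => -α x) (fun i => conj (T (unitSeq h i))) v x‖ₑ /
          ENNReal.ofReal (H * D * t) = (ENNReal.ofReal H)⁻¹ * ‖levelFun (fun x => -α x)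
            (fun i => conj (((c : ℂ) • T) (unitSeq h i))) v x‖ₑ := by
        rw [hsc, enorm_mul, hcn, hc, ENNReal.ofReal_inv_of_pos (by positivity), div_eq_mul_inv,
          mul_assoc H D t, ENNReal.ofReal_mul hH0.le,
          ENNReal.mul_inv (Or.inr ENNReal.ofReal_ne_top) (Or.inl ENNReal.ofReal_ne_top)]
        ring
      rw [hdiv, ENNReal.mul_rpow_of_nonneg _ _ (hr0 x).le]
      gcongr
      calc (ENNReal.ofReal H)⁻¹ ^ conjExp q x ≤ (ENNReal.ofReal H)⁻¹ ^ (1 : ℝ) :=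
            ENNReal.rpow_le_rpow_of_exponent_ge
              (ENNReal.inv_le_one.2 (by simpa using hH1)) (h.one_lt_conj x).le
        _ = _ := ENNReal.rpow_one _
    calc _ ≤ _ := hstep
      _ ≤ (ENNReal.ofReal H)⁻¹ * (ENNReal.ofReal H * volume (dyadicCube J M)) := by gcongr
      _ = volume (dyadicCube J M) := by
          rw [← mul_assoc, ENNReal.inv_mul_cancel (by simpa using hH0) ENNReal.ofReal_ne_top,
            one_mul]
  have hlim : Filter.Tendsto (fun t : ℝ => ENNReal.ofReal (H * D * t))
      (nhdsWithin ‖T‖ (Set.Ioi ‖T‖)) (nhds (ENNReal.ofReal (H * D * ‖T‖))) := by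
    refine Filter.Tendsto.mono_left ?_ nhdsWithin_le_nhds
    exact (ENNReal.continuous_ofReal.comp (continuous_const_mul _)).tendsto _
  rw [← ofReal_norm, ← ENNReal.ofReal_mul (by positivity)]
  refine ge_of_tendsto hlim ?_
  filter_upwards [self_mem_nhdsWithin] with t ht using key t ht

end VarTL

theorem theorem4p10 (n : ℕ) (hn : 1 ≤ n) (α q : EuclideanSpace ℝ (Fin n) → ℝ)
    (hα : VarTL.LocLogHolder α) (hq : VarTL.MemPlog q)
    (hq_inf : 1 < VarTL.expInf q) (hq_sup : VarTL.expSup q < ∞) :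
    -- each element of the `b̃`-space gives a continuous functional, with equivalent norms
    (∃ c C : ℝ≥0, 0 < c ∧ 0 < C ∧
      ∀ lam ∈ VarTL.bSpace (fun x => -α x) (VarTL.conjExp q) (VarTL.conjExp q),
        ∃ T : StrongDual ℂ (VarTL.FSpace α q hα.measurable hq.memP),
          (∀ s, HasSum (fun i => s.seq i * conj (lam i)) (T s)) ∧
          c * VarTL.bNorm (fun x => -α x) (VarTL.conjExp q) (VarTL.conjExp q) lam ≤ ‖T‖ₑ ∧
          ‖T‖ₑ ≤ C * VarTL.bNorm (fun x => -α x) (VarTL.conjExp q) (VarTL.conjExp q) lam) ∧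
    -- every continuous functional arises in this way, from exactly one element
    (∀ T : StrongDual ℂ (VarTL.FSpace α q hα.measurable hq.memP),
      ∃! lam : VarTL.Idx n → ℂ,
        lam ∈ VarTL.bSpace (fun x => -α x) (VarTL.conjExp q) (VarTL.conjExp q) ∧
        ∀ s, HasSum (fun i => s.seq i * conj (lam i)) (T s)) := by
  obtain ⟨L, R, h⟩ := VarTL.exists_exponentControl hα hq hq_inf hq_sup
  have hlower := fun T : StrongDual ℂ (VarTL.FSpace α q hα.measurable hq.memP) =>
    VarTL.bNorm_conj_apply_unitSeq_le h T
  set B : ℝ := 3 * 2 ^ (L * R + L) * (2 * 2 ^ (L * R + L * R)) with hB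
  have hB0 : 0 < B := by positivity
  refine ⟨⟨(Real.toNNReal B)⁻¹, 4, by simpa using hB0, by norm_num, fun lam hlam => ?_⟩,
    fun T => ?_⟩
  · obtain ⟨T, hT, hle⟩ := VarTL.exists_functional (hα := hα.measurable) (hq := hq.memP) h hlam
    refine ⟨T, hT, ?_, by exact_mod_cast hle⟩
    have hBne : Real.toNNReal B ≠ 0 := by simpa using hB0
    rw [ENNReal.coe_inv hBne, ENNReal.inv_mul_le_iff (by exact_mod_cast hBne) ENNReal.coe_ne_top,
      VarTL.eq_conj_apply_unitSeq h T hT]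
    exact hlower T
  · refine ⟨fun i => conj (T (VarTL.unitSeq h i)), ⟨?_, VarTL.hasSum_apply_unitSeq h T⟩,
      fun lam hlam => VarTL.eq_conj_apply_unitSeq h T hlam.2⟩
    exact (hlower T).trans_lt (ENNReal.mul_lt_top ENNReal.ofReal_lt_top enorm_lt_top)
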